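/- Let $d\ge 1$ and $n\ge\max(68,4d)$ be integers and let $\sigma,\lambda>0$. For $\theta=(\mu_1,\mu_2)\in\mathbb R^d\times\mathbb R^d$ let $P_\theta$ be the mixture $\tfrac12\mathcal N(\mu_1,\sigma^2I)+\tfrac12\mathcal N(\mu_2,\sigma^2I)$, and let $\Theta_\lambda=\{(\mu_1,\mu_2):\|\mu_1-\mu_2\|\ge\lambda\}$. Let $F_\theta(x)=\operatorname{argmax}_{i\in\{1,2\}}f(x;\mu_i,\sigma^2I)$ be the Bayes assignment, where $f(\cdot;\mu,\Sigma)$ is the density of $\mathcal N(\mu,\Sigma)$, and for $F:\mathbb R^d\to\{1,2\}$ define the clustering loss $$L_\theta(F)=\min_\pi P_\theta\big(\{x:F_\theta(x)\ne\pi(F(x))\}\big),$$ the minimum being over the permutations $\pi$ of $\{1,2\}$. Given $X_1,\dots,X_n$ i.i.d. from $P_\theta$, let $\widehat\mu_n=\frac1n\sum_{i=1}^nX_i$ and $\widehat\Sigma_n=\frac1n\sum_{i=1}^n(X_i-\widehat\mu_n)(X_i-\widehat\mu_n)^T$, let $v_1(\widehat\Sigma_n)$ be an eigenvector of $\widehat\Sigma_n$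 for its largest eigenvalue (chosen, as a function of the data, in any way), and define $$\widehat F_n(x)=\begin{cases}1&\text{if }x^Tv_1(\widehat\Sigma_n)\ge\widehat\mu_n^Tv_1(\widehat\Sigma_n),\\2&\text{otherwise.}\end{cases}$$ Then $$\sup_{\theta\in\Theta_\lambda}\mathbb E_\theta L_\theta(\widehat F_n)\le 600\max\Big(\frac{4\sigma^2}{\lambda^2},1\Big)\sqrt{\frac{d\log(nd)}{n}}.$$ If moreover $\frac{\lambda}{\sigma}\ge 2\max(80,14\sqrt{5d})$, then $$\sup_{\theta\in\Theta_\lambda}\mathbb E_\theta L_\theta(\widehat F_n)\le 17\exp\Big(-\frac n{32}\Big)+9\exp\Big(-\frac{\lambda^2}{80\sigma^2}\Big).$$ (If the chosen eigenvector is not a measurable function of the data, $\mathbb E_\theta$ is the outer expectation.) -/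

import Mathlib

open MeasureTheory
open scoped ENNReal

noncomputable section

namespace GaussianMixtureClustering

/-- The density `f(x; m, σ² I)` of the isotropic normal law `N(m, σ² I)` on `ℝ^d`. -/
def gaussianDensity {d : ℕ} (σ : ℝ) (m x : EuclideanSpace ℝ (Fin d)) : ℝ :=
  (Real.sqrt (2 * Real.pi * σ ^ 2) ^ d)⁻¹ * Real.exp (-‖x - m‖ ^ 2 / (2 * σ ^ 2))

/-- The equal-weight mixture density `p_θ`, where `θ = (μ₁, μ₂)`. -/
def mixtureDensity {d : ℕ} (σ : ℝ)
    (θ : EuclideanSpace ℝ (Fin d) × EuclideanSpace ℝ (Fin d))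
    (x : EuclideanSpace ℝ (Fin d)) : ℝ :=
  1 / 2 * gaussianDensity σ θ.1 x + 1 / 2 * gaussianDensity σ θ.2 x

/-- The law `P_θ` with Lebesgue density `p_θ`. -/
def mixtureMeasure {d : ℕ} (σ : ℝ)
    (θ : EuclideanSpace ℝ (Fin d) × EuclideanSpace ℝ (Fin d)) :
    Measure (EuclideanSpace ℝ (Fin d)) :=
  volume.withDensity fun x => ENNReal.ofReal (mixtureDensity σ θ x)

/-- The law of an i.i.d. sample `X₁, …, X_n` from `P_θ`. -/
def sampleMeasure {d : ℕ} (n : ℕ) (σ : ℝ)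
    (θ : EuclideanSpace ℝ (Fin d) × EuclideanSpace ℝ (Fin d)) :
    Measure (Fin n → EuclideanSpace ℝ (Fin d)) :=
  Measure.pi fun _ => mixtureMeasure σ θ

/-- The parameter class `Θ_λ`: pairs of means at distance at least `λ`. -/
def parameterClass (d : ℕ) (lam : ℝ) :
    Set (EuclideanSpace ℝ (Fin d) × EuclideanSpace ℝ (Fin d)) :=
  {θ | lam ≤ ‖θ.1 - θ.2‖}

open Classical in
/-- The Bayes assignment `F_θ(x) = argmax_i f(x; μ_i, σ² I)`. The two clusters `1`, `2` are
labelled `0`, `1 : Fin 2`. A tie (a Lebesgue-null set of `x` when `μ₁ ≠ μ₂`) goes to the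
first cluster. -/
def bayesAssignment {d : ℕ} (σ : ℝ)
    (θ : EuclideanSpace ℝ (Fin d) × EuclideanSpace ℝ (Fin d))
    (x : EuclideanSpace ℝ (Fin d)) : Fin 2 :=
  if gaussianDensity σ θ.2 x ≤ gaussianDensity σ θ.1 x then 0 else 1

/-- The clustering loss `L_θ(F) = min_π P_θ {x : F_θ(x) ≠ π(F(x))}`. -/
def clusteringLoss {d : ℕ} (σ : ℝ)
    (θ : EuclideanSpace ℝ (Fin d) × EuclideanSpace ℝ (Fin d))
    (F : EuclideanSpace ℝ (Fin d) → Fin 2) : ℝ≥0∞ :=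
  ⨅ π : Equiv.Perm (Fin 2), mixtureMeasure σ θ {x | bayesAssignment σ θ x ≠ π (F x)}

/-- The sample mean `n⁻¹ ∑ X_i`. -/
def sampleMean {d n : ℕ} (X : Fin n → EuclideanSpace ℝ (Fin d)) : EuclideanSpace ℝ (Fin d) :=
  (n : ℝ)⁻¹ • ∑ i, X i

/-- The sample covariance `n⁻¹ ∑ (X_i - μ̂)(X_i - μ̂)ᵀ`. -/
def sampleCovariance {d n : ℕ} (X : Fin n → EuclideanSpace ℝ (Fin d)) :
    Matrix (Fin d) (Fin d) ℝ :=
  (n : ℝ)⁻¹ • ∑ i, Matrix.vecMulVec (X i - sampleMean X) (X i - sampleMean X)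

/-- `v` is an eigenvector of `A` belonging to the largest (real) eigenvalue of `A`. -/
def IsTopEigenvector {d : ℕ} (A : Matrix (Fin d) (Fin d) ℝ)
    (v : EuclideanSpace ℝ (Fin d)) : Prop :=
  ∃ a : ℝ, Module.End.HasEigenvector (Matrix.toEuclideanLin A) a v ∧
    ∀ b : ℝ, Module.End.HasEigenvalue (Matrix.toEuclideanLin A) b → b ≤ a

open Classical in
/-- The assignment `F̂(x) = 1` if `xᵀ v ≥ x₀ᵀ v`, and `2` otherwise (labels `0`, `1 : Fin 2`). -/
def linearAssignment {d : ℕ} (v x₀ : EuclideanSpace ℝ (Fin d))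
    (x : EuclideanSpace ℝ (Fin d)) : Fin 2 :=
  if inner ℝ x₀ v ≤ inner ℝ x v then 0 else 1

/-- The outer expectation of a nonnegative function that is not assumed measurable: the infimum
of the expectations of its measurable majorants. -/
def outerExpectation {Ω : Type*} [MeasurableSpace Ω] (P : Measure Ω) (f : Ω → ℝ≥0∞) : ℝ≥0∞ :=
  ⨅ (g : Ω → ℝ≥0∞) (_ : Measurable g) (_ : ∀ ω, f ω ≤ g ω), ∫⁻ ω, g ω ∂P

/-- For an almost everywhere measurable function, the outer expectation is the expectation. -/
theorem outerExpectation_eq_lintegral {Ω : Type*} [MeasurableSpace Ω] (P : Measure Ω)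
    {f : Ω → ℝ≥0∞} (hf : AEMeasurable f P) : outerExpectation P f = ∫⁻ ω, f ω ∂P := by
  refine le_antisymm ?_ ?_
  · obtain ⟨N, hN, hNm, hN0⟩ := exists_measurable_superset_of_null (ae_iff.mp hf.ae_eq_mk)
    have hg : Measurable (fun ω => hf.mk f ω + N.indicator (fun _ => ∞) ω) :=
      hf.measurable_mk.add (measurable_const.indicator hNm)
    have hle : ∀ ω, f ω ≤ hf.mk f ω + N.indicator (fun _ => ∞) ω := by
      intro ω
      by_cases h : ω ∈ N
      · simp [h]
      · have : f ω = hf.mk f ω := by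
          by_contra h'
          exact h (hN h')
        simp [h, this]
    have hinf : outerExpectation P f ≤ ∫⁻ ω, (hf.mk f ω + N.indicator (fun _ => ∞) ω) ∂P := by
      unfold outerExpectation
      refine (iInf_le _ fun ω => hf.mk f ω + N.indicator (fun _ => ∞) ω).trans ?_
      refine (iInf_le _ hg).trans ?_
      exact iInf_le _ hle
    refine hinf.trans ?_
    rw [lintegral_add_left hf.measurable_mk, lintegral_indicator hNm,
      lintegral_congr_ae hf.ae_eq_mk.symm]
    simp [hN0]
  · exact le_iInf fun g => le_iInf fun _ => le_iInf fun h => lintegral_mono h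

/-- The expected loss `E_θ L_θ(F̂)` of the estimator that projects onto `v X`, an eigenvector
computed from the sample `X`, and thresholds at the projected sample mean. -/
def expectedLoss {d n : ℕ} (σ : ℝ)
    (v : (Fin n → EuclideanSpace ℝ (Fin d)) → EuclideanSpace ℝ (Fin d))
    (θ : EuclideanSpace ℝ (Fin d) × EuclideanSpace ℝ (Fin d)) : ℝ≥0∞ :=
  outerExpectation (sampleMeasure n σ θ)
    fun X => clusteringLoss σ θ (linearAssignment (v X) (sampleMean X))

end GaussianMixtureClustering

end

noncomputable section

namespace GaussianMixtureClustering

/-! ### Gaussian product measures and densities -/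

open ProbabilityTheory

/-! Center the space at the midpoint of the means, rotate so that the separation is along the first
axis, and rescale by `σ`. With `γ = ‖μ₁ - μ₂‖ / (2σ)`, an observation has first coordinate `γ s + a`
and remaining coordinates `y`, where `s` is a fair sign and `(a, y)` is standard Gaussian,
independent of `s`. The Bayes rule is the sign of the first coordinate. If the top eigenvector has
coordinates `(α, w)` with `α ≠ 0`, put `β = w / α` and let `τ` be the sample mean paired with `(1,
β)`. Then, up to relabelling, the PCA rule disagrees with the Bayes rule only when `|γ s + a| ≤ |β ·
y - τ|` (`clusteringLoss_le`). It remains to bound `|β|`, the tangent of the angular error, and the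
threshold error `τ`. The eigenvector enters only through the fact that its empirical variance is at
least that of the first axis.

First bound. The event above has probability at most `2 / max 1 γ * (|β| + |τ|)`
(`latentMeasure_abs_le`). If the empirical variance along the first axis exceeds all variances
orthogonal to it by `G`, then `|β| ≤ 2|g| / G`, with `g` the empirical cross-covariance
(`tangent_le_of_gap`); here `G = γ² / 2`. Thus the loss is at most `M * lossStat`, with `M = max (1
/ γ²) 1` and `lossStat` a positive combination of absolute values and norms of averages of centred
variables. Its expectation has order `√(d / n)` by second moments alone. The coefficients are so
large that `M * lossStat ≥ 1` whenever one of the scalar conditions behind the gap fails, so those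
conditions need no tail bounds. Only the operator norm of the orthogonal noise covariance needs one:
Chernoff and a union bound over a grid (`latentSample_largeNoise_le`). The logarithm pays for the
grid: if the claimed bound is below `1`, then `n` exceeds a multiple of `M² d log (nd)`.

Second bound. When `γ²` is at least a constant times `d`, a trace bound and approximate balance of
the labels already force `|β| ≤ 1 / 2` and `|τ| ≤ 2γ / 5` (`tangent_le_of_separation`,
`abs_threshold_le`). A disagreement then needs a Gaussian deviation of order `γ`, which gives the
exponential rate. -/

theorem lintegral_pi_prod {n : ℕ} {α : Fin n → Type*} [∀ i, MeasurableSpace (α i)]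
    (μ : ∀ i, Measure (α i)) [∀ i, SigmaFinite (μ i)] (f : ∀ i, α i → ℝ≥0∞)
    (hf : ∀ i, Measurable (f i)) :
    ∫⁻ x, ∏ i, f i (x i) ∂(Measure.pi μ) = ∏ i, ∫⁻ x, f i x ∂(μ i) := by
  induction n with
  | zero => simp
  | succ n ih =>
    rw [← ((measurePreserving_piFinSuccAbove μ 0).symm).lintegral_comp_emb
      (MeasurableEquiv.measurableEmbedding _)]
    simp only [Fin.prod_univ_succ, Fin.zero_succAbove]
    rw [← ih (fun i => μ i.succ) (fun i => f i.succ) (fun i => hf _),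
      ← lintegral_prod_mul (hf 0).aemeasurable]
    rfl
    exact (Finset.measurable_prod _ fun i _ => (hf _).comp (measurable_pi_apply i)).aemeasurable

theorem pi_withDensity {n : ℕ} (f : Fin n → ℝ → ℝ≥0∞) (hf : ∀ i, Measurable (f i))
    [∀ i, SigmaFinite ((volume : Measure ℝ).withDensity (f i))] :
    Measure.pi (fun i => (volume : Measure ℝ).withDensity (f i)) =
      (volume : Measure (Fin n → ℝ)).withDensity fun x => ∏ i, f i (x i) := by
  refine Measure.pi_eq (μ := fun i => (volume : Measure ℝ).withDensity (f i))
    fun s hs => ?_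
  rw [withDensity_apply _ (MeasurableSet.univ_pi hs), volume_pi, Measure.restrict_pi_pi,
    lintegral_pi_prod (fun i => volume.restrict (s i)) f hf]
  simp_rw [withDensity_apply _ (hs _)]

/-- Scaling and translating a standard Gaussian vector gives the law with density
`gaussianDensity`. -/
theorem map_stdGaussian_eq_withDensity {d : ℕ} {σ : ℝ} (hσ : 0 < σ)
    (m : EuclideanSpace ℝ (Fin d)) :
    (stdGaussian (EuclideanSpace ℝ (Fin d))).map (fun z => m + σ • z) =
      volume.withDensity fun x => ENNReal.ofReal (gaussianDensity σ m x) := by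
  have hv : NNReal.mk (σ ^ 2) (sq_nonneg σ) ≠ 0 := by
    intro h
    exact (pow_pos hσ 2).ne' (congrArg NNReal.toReal h)
  have hpi : (Measure.pi fun _ : Fin d => gaussianReal 0 1).map (fun y i => m i + σ * y i) =
      (volume : Measure (Fin d → ℝ)).withDensity fun x =>
        ∏ i, gaussianPDF (m i) (NNReal.mk (σ ^ 2) (sq_nonneg σ)) (x i) := by
    have h1 : ∀ i, (gaussianReal 0 1).map (fun y => m i + σ * y) =
        volume.withDensity (gaussianPDF (m i) (NNReal.mk (σ ^ 2) (sq_nonneg σ))) := by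
      intro i
      rw [← gaussianReal_of_var_ne_zero _ hv]
      have := gaussianReal_map_const_mul (μ := 0) (v := 1) σ
      have h2 : (fun y => m i + σ * y) = (fun y => m i + y) ∘ (fun y => σ * y) := rfl
      rw [h2, ← Measure.map_map (by fun_prop) (by fun_prop), this, gaussianReal_map_const_add]
      simp
    have : ∀ i, SigmaFinite ((volume : Measure ℝ).withDensity
        (gaussianPDF (m i) (NNReal.mk (σ ^ 2) (sq_nonneg σ)))) := by
      intro i; rw [← h1]
      have : IsProbabilityMeasure ((gaussianReal 0 1).map (fun y => m i + σ * y)) :=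
        Measure.isProbabilityMeasure_map (Measurable.aemeasurable (by fun_prop))
      infer_instance
    rw [← pi_withDensity (fun i => gaussianPDF (m i) (NNReal.mk (σ ^ 2) (sq_nonneg σ)))
      (fun i => measurable_gaussianPDF _ _)]
    have : ∀ i, SigmaFinite ((gaussianReal 0 1).map (fun y => m i + σ * y)) := by
      intro i; rw [h1]; infer_instance
    rw [Measure.pi_map_pi (f := fun i y => m i + σ * y) (fun i => by fun_prop)]
    simp_rw [h1]
  rw [← map_pi_eq_stdGaussian, Measure.map_map (by fun_prop) (by fun_prop)]
  have h3 : (fun z : EuclideanSpace ℝ (Fin d) => m + σ • z) ∘ WithLp.toLp 2 =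
      (MeasurableEquiv.toLp 2 (Fin d → ℝ)) ∘ (fun y i => m i + σ * y i) := by
    ext y i
    simp
  rw [h3, ← Measure.map_map (MeasurableEquiv.measurable _) (by fun_prop), hpi]
  have hvol := EuclideanSpace.volume_preserving_symm_measurableEquiv_toLp (Fin d)
  ext s hs
  rw [Measure.map_apply (MeasurableEquiv.measurable _) hs, withDensity_apply _ hs,
    withDensity_apply _ ((MeasurableEquiv.measurable _) hs),
    ← hvol.setLIntegral_comp_preimage_emb (MeasurableEquiv.measurableEmbedding _)]
  have : (MeasurableEquiv.toLp 2 (Fin d → ℝ)).symm ⁻¹'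
      ((MeasurableEquiv.toLp 2 (Fin d → ℝ)) ⁻¹' s) = s := by
    ext x; simp
  rw [this]
  congr 1
  ext x
  simp only [gaussianPDF, gaussianPDFReal]
  rw [← ENNReal.ofReal_prod_of_nonneg (fun i _ => by positivity)]
  congr 1
  rw [Finset.prod_mul_distrib, Finset.prod_const, Finset.card_univ, Fintype.card_fin,
    ← Real.exp_sum, gaussianDensity, inv_pow, EuclideanSpace.real_norm_sq_eq,
    ← Finset.sum_div, Finset.sum_neg_distrib]
  rfl

/-! ### Latent variables: label and noise -/

/-- The sign `±1` of a cluster label. -/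
def labelSign (s : Bool) : ℝ := if s then 1 else -1

theorem labelSign_sq (s : Bool) : labelSign s ^ 2 = 1 := by cases s <;> simp [labelSign]

theorem abs_labelSign (s : Bool) : |labelSign s| = 1 := by cases s <;> simp [labelSign]

/-- The fair coin. -/
def labelMeasure : Measure Bool :=
  (1 / 2 : ℝ≥0∞) • Measure.dirac true + (1 / 2 : ℝ≥0∞) • Measure.dirac false

instance : IsProbabilityMeasure labelMeasure := by
  constructor
  simp [labelMeasure, ENNReal.inv_two_add_inv_two]

/-- Standard Gaussian noise, with one coordinate singled out. -/
def noiseMeasure (m : ℕ) : Measure (ℝ × (Fin m → ℝ)) :=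
  (gaussianReal 0 1).prod (Measure.pi fun _ => gaussianReal 0 1)

instance (m : ℕ) : IsProbabilityMeasure (noiseMeasure m) := by
  unfold noiseMeasure; infer_instance

/-- The space of latent variables: a label and the noise. -/
abbrev Latent (m : ℕ) : Type := Bool × ℝ × (Fin m → ℝ)

/-- The law of the latent variables. -/
def latentMeasure (m : ℕ) : Measure (Latent m) := labelMeasure.prod (noiseMeasure m)

instance (m : ℕ) : IsProbabilityMeasure (latentMeasure m) := by
  unfold latentMeasure; infer_instance

theorem lintegral_latentMeasure {m : ℕ} {f : Latent m → ℝ≥0∞} (hf : Measurable f) :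
    ∫⁻ ω, f ω ∂(latentMeasure m) =
      1 / 2 * ∫⁻ z, f (true, z) ∂(noiseMeasure m) +
        1 / 2 * ∫⁻ z, f (false, z) ∂(noiseMeasure m) := by
  rw [latentMeasure, lintegral_prod _ hf.aemeasurable, labelMeasure, lintegral_add_measure,
    lintegral_smul_measure, lintegral_smul_measure, lintegral_dirac, lintegral_dirac]
  rfl

/-! ### Coordinates adapted to the separation direction -/

section Frame

variable {m n : ℕ} (b : OrthonormalBasis (Fin (m + 1)) ℝ (EuclideanSpace ℝ (Fin (m + 1))))

/-- The vector with coordinates `p, q` in the basis `b`. -/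
def frame (p : ℝ) (q : Fin m → ℝ) : EuclideanSpace ℝ (Fin (m + 1)) :=
  p • b 0 + ∑ j, q j • b j.succ

theorem frame_eq_sum (p : ℝ) (q : Fin m → ℝ) :
    frame b p q = ∑ i, (Fin.cons p q : Fin (m + 1) → ℝ) i • b i := by
  simp [frame, Fin.sum_univ_succ]

theorem inner_frame_frame (p p' : ℝ) (q q' : Fin m → ℝ) :
    inner ℝ (frame b p q) (frame b p' q') = p * p' + ∑ j, q j * q' j := by
  rw [frame_eq_sum, frame_eq_sum, b.orthonormal.inner_sum]
  simp [Fin.sum_univ_succ]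

theorem frame_inner_self (x : EuclideanSpace ℝ (Fin (m + 1))) :
    frame b (inner ℝ (b 0) x) (fun j => inner ℝ (b j.succ) x) = x := by
  conv_rhs => rw [← b.sum_repr' x, Fin.sum_univ_succ]
  rfl

theorem inner_basis_zero_frame (p : ℝ) (q : Fin m → ℝ) : inner ℝ (b 0) (frame b p q) = p := by
  have : b 0 = frame b 1 0 := by simp [frame]
  rw [this, inner_frame_frame]; simp

theorem inner_basis_succ_frame (p : ℝ) (q : Fin m → ℝ) (j : Fin m) :
    inner ℝ (b j.succ) (frame b p q) = q j := by
  rw [frame_eq_sum, b.orthonormal.inner_right_fintype]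
  simp

theorem frame_sub (p p' : ℝ) (q q' : Fin m → ℝ) :
    frame b p q - frame b p' q' = frame b (p - p') (q - q') := by
  simp only [frame, sub_smul, Pi.sub_apply, Finset.sum_sub_distrib]
  abel

theorem smul_sum_frame (r : ℝ) (p : Fin n → ℝ) (q : Fin n → Fin m → ℝ) :
    r • ∑ i, frame b (p i) (q i) = frame b (r * ∑ i, p i) (fun j => r * ∑ i, q i j) := by
  simp only [frame, Finset.sum_add_distrib, smul_add, mul_smul, Finset.sum_smul,
    Finset.smul_sum]
  rw [Finset.sum_comm]

@[fun_prop]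
theorem continuous_frame :
    Continuous fun z : ℝ × (Fin m → ℝ) => frame b z.1 z.2 := by
  unfold frame; fun_prop

/-- Rotation invariance of the standard Gaussian: the basis may depend on `θ` without changing the
noise law. -/
theorem map_frame : (noiseMeasure m).map (fun z => frame b z.1 z.2) =
    stdGaussian (EuclideanSpace ℝ (Fin (m + 1))) := by
  rw [stdGaussian_eq_map_pi_orthonormalBasis b, noiseMeasure]
  have h := (measurePreserving_piFinSuccAbove
    (fun _ : Fin (m + 1) => gaussianReal 0 1) 0).symm.map_eq
  rw [← h, Measure.map_map (by fun_prop) (MeasurableEquiv.measurable _)]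
  congr 1
  ext1 z
  simp only [frame, Function.comp, Fin.sum_univ_succ]
  rfl

/-- The observation produced by a latent variable. -/
def embed (c : EuclideanSpace ℝ (Fin (m + 1))) (σ γ : ℝ) (ω : Latent m) :
    EuclideanSpace ℝ (Fin (m + 1)) :=
  c + σ • frame b (γ * labelSign ω.1 + ω.2.1) ω.2.2

theorem measurable_embed (c : EuclideanSpace ℝ (Fin (m + 1))) (σ γ : ℝ) :
    Measurable (embed b c σ γ) := by
  refine measurable_from_prod_countable_right fun s => ?_
  have : Continuous fun z : ℝ × (Fin m → ℝ) => embed b c σ γ (s, z) := by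
    unfold embed frame; fun_prop
  exact this.measurable

theorem map_embed (c : EuclideanSpace ℝ (Fin (m + 1))) {σ : ℝ} (hσ : 0 < σ) (γ : ℝ) :
    (latentMeasure m).map (embed b c σ γ) =
      mixtureMeasure σ (c + (σ * γ) • b 0, c - (σ * γ) • b 0) := by
  have key : ∀ (s : Bool) (A : Set (EuclideanSpace ℝ (Fin (m + 1)))), MeasurableSet A →
      ∫⁻ z, A.indicator 1 (embed b c σ γ (s, z)) ∂(noiseMeasure m) =
        ∫⁻ x in A, ENNReal.ofReal
          (gaussianDensity σ (c + (σ * γ * labelSign s) • b 0) x) := by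
    intro s A hA
    rw [← withDensity_apply _ hA, ← map_stdGaussian_eq_withDensity hσ, ← map_frame b,
      Measure.map_map (by fun_prop) (by fun_prop), ← lintegral_indicator_one hA,
      lintegral_map (measurable_one.indicator hA) (by fun_prop)]
    refine lintegral_congr fun z => ?_
    congr 1
    simp only [embed, Function.comp, frame, smul_add, add_smul, mul_smul]
    rw [add_assoc c, ← add_assoc (σ • _) (σ • _)]
  ext A hA
  rw [← lintegral_indicator_one hA,
    lintegral_map (measurable_one.indicator hA) (measurable_embed b c σ γ),
    lintegral_latentMeasure (f := fun ω => A.indicator 1 (embed b c σ γ ω)) ((measurable_one.indicator hA).comp (measurable_embed b c σ γ)),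
    key _ _ hA, key _ _ hA, mixtureMeasure, withDensity_apply _ hA]
  have hm : ∀ μ : EuclideanSpace ℝ (Fin (m + 1)), Measurable fun x =>
      ENNReal.ofReal (gaussianDensity σ μ x) := by
    intro μ; unfold gaussianDensity; fun_prop
  have hnn : ∀ μ x : EuclideanSpace ℝ (Fin (m + 1)), 0 ≤ gaussianDensity σ μ x := by
    intro μ x; unfold gaussianDensity; positivity
  rw [← lintegral_const_mul _ (hm _), ← lintegral_const_mul _ (hm _),
    ← lintegral_add_left ((hm _).const_mul _)]
  refine lintegral_congr fun x => ?_
  simp only [mixtureDensity, labelSign]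
  rw [ENNReal.ofReal_add (by have := hnn (c + (σ * γ) • b 0) x; positivity)
    (by have := hnn (c - (σ * γ) • b 0) x; positivity),
    ENNReal.ofReal_mul (by norm_num), ENNReal.ofReal_mul (by norm_num)]
  simp [sub_eq_add_neg]

theorem sampleMeasure_eq_map (c : EuclideanSpace ℝ (Fin (m + 1))) {σ : ℝ} (hσ : 0 < σ) (γ : ℝ) :
    sampleMeasure n σ (c + (σ * γ) • b 0, c - (σ * γ) • b 0) =
      (Measure.pi fun _ : Fin n => latentMeasure m).map fun ω i => embed b c σ γ (ω i) := by
  have : IsProbabilityMeasure ((latentMeasure m).map (embed b c σ γ)) :=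
    Measure.isProbabilityMeasure_map (measurable_embed b c σ γ).aemeasurable
  rw [Measure.pi_map_pi (f := fun _ => embed b c σ γ)
    (fun _ => (measurable_embed b c σ γ).aemeasurable), sampleMeasure]
  simp_rw [map_embed b c hσ]

/-- The latent sample with given labels that produces a given sample. -/
def latentOf (c : EuclideanSpace ℝ (Fin (m + 1))) (σ γ : ℝ) (s : Fin n → Bool)
    (X : Fin n → EuclideanSpace ℝ (Fin (m + 1))) (i : Fin n) : Latent m :=
  (s i, inner ℝ (b 0) (σ⁻¹ • (X i - c)) - γ * labelSign (s i),
    fun j => inner ℝ (b j.succ) (σ⁻¹ • (X i - c)))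

theorem measurable_latentOf (c : EuclideanSpace ℝ (Fin (m + 1))) (σ γ : ℝ) (s : Fin n → Bool) :
    Measurable (latentOf b c σ γ s) := by
  unfold latentOf
  fun_prop

theorem embed_latentOf (c : EuclideanSpace ℝ (Fin (m + 1))) {σ : ℝ} (hσ : 0 < σ) (γ : ℝ)
    (s : Fin n → Bool) (X : Fin n → EuclideanSpace ℝ (Fin (m + 1))) (i : Fin n) :
    embed b c σ γ (latentOf b c σ γ s X i) = X i := by
  simp only [embed, latentOf]
  rw [add_sub_cancel, frame_inner_self, smul_inv_smul₀ hσ.ne', add_sub_cancel]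

theorem latentOf_embed (c : EuclideanSpace ℝ (Fin (m + 1))) {σ : ℝ} (hσ : 0 < σ) (γ : ℝ)
    (ω : Fin n → Latent m) :
    latentOf b c σ γ (fun i => (ω i).1) (fun i => embed b c σ γ (ω i)) = ω := by
  ext1 i
  simp only [embed, latentOf, add_sub_cancel_left, inv_smul_smul₀ hσ.ne',
    inner_basis_zero_frame, inner_basis_succ_frame]

/-- The outer expectation needs a measurable majorant on the sample space, while `g` lives on the
latent space. Once the labels are fixed, the noise is recovered from the sample, and the bound `h`
holds for every choice of labels. The minimum of `g` over the finitely many label vectors is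
therefore a measurable majorant, and along the true labels it is at most `g`. -/
theorem expectedLoss_le_lintegral (c : EuclideanSpace ℝ (Fin (m + 1))) {σ : ℝ} (hσ : 0 < σ)
    (γ : ℝ)
    (v : (Fin n → EuclideanSpace ℝ (Fin (m + 1))) → EuclideanSpace ℝ (Fin (m + 1)))
    {θ : EuclideanSpace ℝ (Fin (m + 1)) × EuclideanSpace ℝ (Fin (m + 1))}
    (hθ : θ = (c + (σ * γ) • b 0, c - (σ * γ) • b 0))
    {g : (Fin n → Latent m) → ℝ≥0∞} (hg : Measurable g)
    (h : ∀ ω : Fin n → Latent m, clusteringLoss σ θ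
      (linearAssignment (v fun i => embed b c σ γ (ω i))
        (sampleMean fun i => embed b c σ γ (ω i))) ≤ g ω) :
    expectedLoss σ v θ ≤ ∫⁻ ω, g ω ∂(Measure.pi fun _ => latentMeasure m) := by
  have hT : Measurable fun (ω : Fin n → Latent m) i => embed b c σ γ (ω i) :=
    measurable_pi_lambda _ fun i => (measurable_embed b c σ γ).comp (measurable_pi_apply i)
  have hG : Measurable fun X => ⨅ s : Fin n → Bool, g (latentOf b c σ γ s X) :=
    Measurable.iInf fun s => hg.comp (measurable_latentOf b c σ γ s)
  unfold expectedLoss outerExpectation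
  refine (iInf_le _ fun X => ⨅ s : Fin n → Bool, g (latentOf b c σ γ s X)).trans ?_
  refine (iInf_le _ hG).trans ?_
  refine (iInf_le _ fun X => le_iInf fun s => ?_).trans ?_
  · have := h (latentOf b c σ γ s X)
    simpa only [embed_latentOf b c hσ] using this
  · rw [hθ, sampleMeasure_eq_map b c hσ, lintegral_map hG hT]
    refine lintegral_mono fun ω => ?_
    refine (iInf_le _ fun i => (ω i).1).trans ?_
    simp only [latentOf_embed b c hσ]
    exact le_rfl

end Frame

theorem exists_frame {m : ℕ} {σ : ℝ} (hσ : 0 < σ)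
    (θ : EuclideanSpace ℝ (Fin (m + 1)) × EuclideanSpace ℝ (Fin (m + 1))) (hθ : θ.1 ≠ θ.2) :
    ∃ (b : OrthonormalBasis (Fin (m + 1)) ℝ (EuclideanSpace ℝ (Fin (m + 1))))
      (c : EuclideanSpace ℝ (Fin (m + 1))),
      θ = (c + (σ * (‖θ.1 - θ.2‖ / (2 * σ))) • b 0, c - (σ * (‖θ.1 - θ.2‖ / (2 * σ))) • b 0) := by
  have hne : ‖θ.1 - θ.2‖ ≠ 0 := norm_ne_zero_iff.mpr (sub_ne_zero.mpr hθ)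
  obtain ⟨b, hb⟩ := Orthonormal.exists_orthonormalBasis_extension_of_card_eq (𝕜 := ℝ)
    (E := EuclideanSpace ℝ (Fin (m + 1))) (ι := Fin (m + 1)) (by simp)
    (v := fun _ => ‖θ.1 - θ.2‖⁻¹ • (θ.1 - θ.2)) (s := {0}) (by
      constructor
      · intro i
        simp [norm_smul, hne]
      · intro i j hij
        exact absurd (Subsingleton.elim i j) hij)
  have hb0 : b 0 = ‖θ.1 - θ.2‖⁻¹ • (θ.1 - θ.2) := hb 0 rfl
  refine ⟨b, (1 / 2 : ℝ) • (θ.1 + θ.2), ?_⟩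
  have h1 : σ * (‖θ.1 - θ.2‖ / (2 * σ)) * ‖θ.1 - θ.2‖⁻¹ = 1 / 2 := by
    field_simp
  rw [hb0, smul_smul, h1, ← smul_add, ← smul_sub]
  ext i
  · simp; ring
  · simp; ring

/-! ### Reduction of the loss to an event in latent coordinates -/

/-- The arithmetic mean of finitely many reals. -/
def avg {n : ℕ} (x : Fin n → ℝ) : ℝ := (n : ℝ)⁻¹ * ∑ i, x i

section Reduction

variable {m n : ℕ} (b : OrthonormalBasis (Fin (m + 1)) ℝ (EuclideanSpace ℝ (Fin (m + 1))))

theorem sampleMean_embed (hn : n ≠ 0) (c : EuclideanSpace ℝ (Fin (m + 1))) (σ γ : ℝ)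
    (ω : Fin n → Latent m) :
    sampleMean (fun i => embed b c σ γ (ω i)) =
      c + σ • frame b (avg fun i => γ * labelSign (ω i).1 + (ω i).2.1)
        (fun j => avg fun i => (ω i).2.2 j) := by
  have hn' : (n : ℝ) ≠ 0 := by exact_mod_cast hn
  simp only [avg]
  rw [← smul_sum_frame]
  simp only [sampleMean, embed, Finset.sum_add_distrib (f := fun _ => c), ← Finset.smul_sum,
    smul_add, Finset.sum_const, Finset.card_univ, Fintype.card_fin]
  rw [smul_comm σ, ← Nat.cast_smul_eq_nsmul ℝ, inv_smul_smul₀ hn']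

theorem embed_sub_sampleMean (hn : n ≠ 0) (c : EuclideanSpace ℝ (Fin (m + 1))) (σ γ : ℝ)
    (ω : Fin n → Latent m) (i : Fin n) :
    embed b c σ γ (ω i) - sampleMean (fun i => embed b c σ γ (ω i)) =
      σ • frame b (γ * labelSign (ω i).1 + (ω i).2.1 -
        avg fun i => γ * labelSign (ω i).1 + (ω i).2.1)
        (fun j => (ω i).2.2 j - avg fun i => (ω i).2.2 j) := by
  rw [sampleMean_embed b hn, embed, add_sub_add_left_eq_sub, ← smul_sub, frame_sub]
  rfl

theorem toEuclideanLin_sampleCovariance_inner {d : ℕ} (X : Fin n → EuclideanSpace ℝ (Fin d))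
    (x y : EuclideanSpace ℝ (Fin d)) :
    inner ℝ x (Matrix.toEuclideanLin (sampleCovariance X) y) =
      avg fun i => inner ℝ (X i - sampleMean X) x * inner ℝ (X i - sampleMean X) y := by
  simp only [sampleCovariance, map_smul, map_sum, LinearMap.smul_apply, inner_smul_right,
    LinearMap.sum_apply, inner_sum, avg]
  congr 1
  refine Finset.sum_congr rfl fun i _ => ?_
  rw [EuclideanSpace.inner_eq_star_dotProduct]
  simp only [Matrix.ofLp_toLpLin, Matrix.toLin'_apply, Matrix.vecMulVec_mulVec, star_trivial]
  rw [EuclideanSpace.inner_eq_star_dotProduct, EuclideanSpace.inner_eq_star_dotProduct]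
  simp only [star_trivial, op_smul_eq_smul, smul_dotProduct, smul_eq_mul]
  rw [dotProduct_comm x.ofLp, dotProduct_comm y.ofLp, mul_comm]

theorem isSymmetric_sampleCovariance {d : ℕ} (X : Fin n → EuclideanSpace ℝ (Fin d)) :
    (Matrix.toEuclideanLin (sampleCovariance X)).IsSymmetric := by
  intro x y
  rw [real_inner_comm, toEuclideanLin_sampleCovariance_inner,
    toEuclideanLin_sampleCovariance_inner]
  simp_rw [mul_comm]

/-- Rayleigh's principle, by expansion in an orthonormal eigenbasis. It is stated without division,
so `v` need not be normalized. -/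
theorem IsTopEigenvector.quadratic_le {d : ℕ} {A : Matrix (Fin d) (Fin d) ℝ}
    (hA : (Matrix.toEuclideanLin A).IsSymmetric) {v : EuclideanSpace ℝ (Fin d)}
    (hv : IsTopEigenvector A v) (x : EuclideanSpace ℝ (Fin d)) :
    inner ℝ x (Matrix.toEuclideanLin A x) * ‖v‖ ^ 2 ≤
      inner ℝ v (Matrix.toEuclideanLin A v) * ‖x‖ ^ 2 := by
  obtain ⟨a, hav, ha⟩ := hv
  have hvv : inner ℝ v (Matrix.toEuclideanLin A v) = a * ‖v‖ ^ 2 := by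
    rw [hav.apply_eq_smul, inner_smul_right, real_inner_self_eq_norm_sq]
  have hfin : Module.finrank ℝ (EuclideanSpace ℝ (Fin d)) = d := by simp
  have key : inner ℝ x (Matrix.toEuclideanLin A x) ≤ a * ‖x‖ ^ 2 := by
    set e := hA.eigenvectorBasis hfin
    rw [← e.sum_inner_mul_inner, ← e.sum_sq_inner_right, Finset.mul_sum]
    refine Finset.sum_le_sum fun i _ => ?_
    change _ ≤ a * inner ℝ (e i) x ^ 2
    change inner ℝ x (e i) * inner ℝ (e i) _ ≤ _
    rw [← hA, hA.apply_eigenvectorBasis, inner_smul_left, real_inner_comm]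
    change inner ℝ (e i) x * (_ * inner ℝ (e i) x) ≤ _
    have := ha _ (hA.hasEigenvalue_eigenvalues hfin i)
    simp only [RCLike.conj_to_real]
    have h2 := sq_nonneg (inner ℝ (e i) x)
    have h3 := mul_le_mul_of_nonneg_right this h2
    simp only [RCLike.ofReal_real_eq_id, id] at h3 ⊢
    calc _ = hA.eigenvalues hfin i * inner ℝ (e i) x ^ 2 := by ring
      _ ≤ _ := h3
  rw [hvv]
  nlinarith [sq_nonneg ‖v‖]

/-- Coordinates of the top eigenvector, and its variational property with respect to the first
basis vector. -/
theorem IsTopEigenvector.exists_frame (hn : n ≠ 0) (c : EuclideanSpace ℝ (Fin (m + 1)))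
    {σ : ℝ} (hσ : 0 < σ) (γ : ℝ) (ω : Fin n → Latent m) {v : EuclideanSpace ℝ (Fin (m + 1))}
    (hv : IsTopEigenvector (sampleCovariance fun i => embed b c σ γ (ω i)) v) :
    ∃ (α : ℝ) (w : Fin m → ℝ), v = frame b α w ∧ 0 < α ^ 2 + ∑ j, w j ^ 2 ∧
      (avg fun i => (γ * labelSign (ω i).1 + (ω i).2.1 -
        avg fun i => γ * labelSign (ω i).1 + (ω i).2.1) ^ 2) * (α ^ 2 + ∑ j, w j ^ 2) ≤
      avg fun i => (α * (γ * labelSign (ω i).1 + (ω i).2.1 -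
          avg fun i => γ * labelSign (ω i).1 + (ω i).2.1) +
        ∑ j, w j * ((ω i).2.2 j - avg fun i => (ω i).2.2 j)) ^ 2 := by
  refine ⟨inner ℝ (b 0) v, fun j => inner ℝ (b j.succ) v, (frame_inner_self b v).symm, ?_⟩
  set α : ℝ := inner ℝ (b 0) v with hα
  set w : Fin m → ℝ := fun j => inner ℝ (b j.succ) v with hw
  have hvf : frame b α w = v := frame_inner_self b v
  have hnorm : ‖v‖ ^ 2 = α ^ 2 + ∑ j, w j ^ 2 := by
    rw [← hvf, ← real_inner_self_eq_norm_sq, inner_frame_frame]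
    simp [sq]
  have hv0 : v ≠ 0 := by obtain ⟨a, ha, -⟩ := hv; exact ha.2
  refine ⟨?_, ?_⟩
  · rw [← hnorm]; exact pow_pos (norm_pos_iff.mpr hv0) 2
  -- The separation axis is the only competitor that is ever compared with the eigenvector.
  · have h := hv.quadratic_le (isSymmetric_sampleCovariance _) (frame b 1 0)
    rw [toEuclideanLin_sampleCovariance_inner, toEuclideanLin_sampleCovariance_inner, hnorm] at h
    have h1 : ‖frame b 1 (0 : Fin m → ℝ)‖ ^ 2 = 1 := by
      rw [← real_inner_self_eq_norm_sq, inner_frame_frame]; simp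
    rw [h1, ← hvf] at h
    simp only [embed_sub_sampleMean b hn, real_inner_smul_left, inner_frame_frame] at h
    simp only [Pi.zero_apply, mul_zero, Finset.sum_const_zero, add_zero, mul_one] at h
    have e1 : ∀ x : Fin n → ℝ, (avg fun i => σ * x i * (σ * x i)) =
        σ ^ 2 * avg fun i => x i ^ 2 := by
      intro x
      simp only [avg, Finset.mul_sum]
      refine Finset.sum_congr rfl fun i _ => by ring
    rw [e1 fun i => γ * labelSign (ω i).1 + (ω i).2.1 -
      avg fun i => γ * labelSign (ω i).1 + (ω i).2.1, e1, mul_assoc] at h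
    have h2 := le_of_mul_le_mul_left h (pow_pos hσ 2)
    refine h2.trans (le_of_eq ?_)
    congr 1
    ext i
    congr 1
    rw [mul_comm α]
    congr 1
    exact Finset.sum_congr rfl fun j _ => mul_comm _ _

theorem clusteringLoss_le_one (c : EuclideanSpace ℝ (Fin (m + 1))) {σ : ℝ} (hσ : 0 < σ) (γ : ℝ)
    (F : EuclideanSpace ℝ (Fin (m + 1)) → Fin 2) :
    clusteringLoss σ (c + (σ * γ) • b 0, c - (σ * γ) • b 0) F ≤ 1 := by
  refine (iInf_le _ 1).trans ?_
  rw [← map_embed b c hσ γ]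
  have : IsProbabilityMeasure ((latentMeasure m).map (embed b c σ γ)) :=
    Measure.isProbabilityMeasure_map (measurable_embed b c σ γ).aemeasurable
  exact prob_le_one

theorem bayesAssignment_frame (c : EuclideanSpace ℝ (Fin (m + 1))) {σ γ : ℝ} (hσ : 0 < σ)
    (hγ : 0 < γ) (p : ℝ) (q : Fin m → ℝ) :
    bayesAssignment σ (c + (σ * γ) • b 0, c - (σ * γ) • b 0) (c + σ • frame b p q) =
      if 0 ≤ p then 0 else 1 := by
  unfold bayesAssignment gaussianDensity
  congr 1
  have h0 : ∀ r : ℝ, r • b 0 = frame b r 0 := by intro r; simp [frame]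
  have e1 : ‖c + σ • frame b p q - (c + (σ * γ) • b 0)‖ ^ 2 =
      σ ^ 2 * ((p - γ) ^ 2 + ∑ j, q j * q j) := by
    rw [mul_smul, add_sub_add_left_eq_sub, ← smul_sub, h0, frame_sub, norm_smul, mul_pow,
      ← real_inner_self_eq_norm_sq (frame _ _ _), inner_frame_frame]
    simp [sq]
  have e2 : ‖c + σ • frame b p q - (c - (σ * γ) • b 0)‖ ^ 2 =
      σ ^ 2 * ((p + γ) ^ 2 + ∑ j, q j * q j) := by
    rw [sub_eq_add_neg c, ← neg_smul, ← mul_neg, mul_smul, add_sub_add_left_eq_sub, ← smul_sub,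
      h0, frame_sub, norm_smul, mul_pow, ← real_inner_self_eq_norm_sq (frame _ _ _),
      inner_frame_frame]
    simp [sq]
  simp only [e1, e2, eq_iff_iff]
  have hs : 0 < (Real.sqrt (2 * Real.pi * σ ^ 2) ^ (m + 1))⁻¹ := by positivity
  rw [mul_le_mul_iff_right₀ hs, Real.exp_le_exp,
    div_le_div_iff_of_pos_right (by positivity), neg_le_neg_iff,
    mul_le_mul_iff_right₀ (by positivity), add_le_add_iff_right]
  constructor
  · intro h
    by_contra hp
    nlinarith
  · intro h
    nlinarith

theorem linearAssignment_frame (c : EuclideanSpace ℝ (Fin (m + 1))) {σ : ℝ} (hσ : 0 < σ)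
    (α p p₀ : ℝ) (w q q₀ : Fin m → ℝ) :
    linearAssignment (frame b α w) (c + σ • frame b p₀ q₀) (c + σ • frame b p q) =
      if 0 ≤ α * (p - p₀) + ∑ j, w j * (q j - q₀ j) then 0 else 1 := by
  unfold linearAssignment
  congr 1
  rw [eq_iff_iff, ← sub_nonneg, ← inner_sub_left, add_sub_add_left_eq_sub, ← smul_sub, frame_sub,
    real_inner_smul_left, inner_frame_frame, mul_nonneg_iff_of_pos_left hσ]
  simp only [Pi.sub_apply, mul_comm]

/-- Bayes compares `p` with `0` and PCA compares `α (p + r)` with `0`. After the sign of `α` is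
absorbed by a permutation, they can differ only if `-r` lies between `0` and `p` or beyond, in the
sense that `|p| ≤ |r|`. -/
theorem clusteringLoss_le (c : EuclideanSpace ℝ (Fin (m + 1))) {σ γ : ℝ} (hσ : 0 < σ)
    (hγ : 0 < γ) {α : ℝ} (hα : α ≠ 0) (p₀ : ℝ) (w q₀ : Fin m → ℝ) :
    clusteringLoss σ (c + (σ * γ) • b 0, c - (σ * γ) • b 0)
        (linearAssignment (frame b α w) (c + σ • frame b p₀ q₀)) ≤
      latentMeasure m {ω | |γ * labelSign ω.1 + ω.2.1| ≤
        |∑ j, w j / α * ω.2.2 j - (p₀ + ∑ j, w j / α * q₀ j)|} := by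
  set B : Set (EuclideanSpace ℝ (Fin (m + 1))) := {x | |inner ℝ (b 0) (σ⁻¹ • (x - c))| ≤
    |∑ j, w j / α * inner ℝ (b j.succ) (σ⁻¹ • (x - c)) - (p₀ + ∑ j, w j / α * q₀ j)|} with hB
  have hBm : MeasurableSet B := measurableSet_le (by fun_prop) (by fun_prop)
  have hpre : embed b c σ γ ⁻¹' B = {ω | |γ * labelSign ω.1 + ω.2.1| ≤
        |∑ j, w j / α * ω.2.2 j - (p₀ + ∑ j, w j / α * q₀ j)|} := by
    ext ω
    simp only [hB, embed, Set.mem_preimage, Set.mem_ofPred_eq, add_sub_cancel_left,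
      inv_smul_smul₀ hσ.ne', inner_basis_zero_frame, inner_basis_succ_frame]
  rw [← hpre, ← Measure.map_apply (measurable_embed b c σ γ) hBm, map_embed b c hσ]
  -- An eigenvector is determined only up to sign; the swap corrects a reversed orientation.
  refine (iInf_le _ (if 0 < α then 1 else Equiv.swap 0 1)).trans (measure_mono ?_)
  intro x hx
  obtain ⟨p, q, rfl⟩ : ∃ p q, x = c + σ • frame b p q :=
    ⟨inner ℝ (b 0) (σ⁻¹ • (x - c)), fun j => inner ℝ (b j.succ) (σ⁻¹ • (x - c)), by
      rw [frame_inner_self, smul_inv_smul₀ hσ.ne', add_sub_cancel]⟩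
  simp only [hB, Set.mem_ofPred_eq, add_sub_cancel_left,
      inv_smul_smul₀ hσ.ne', inner_basis_zero_frame, inner_basis_succ_frame]
  simp only [Set.mem_ofPred_eq, bayesAssignment_frame b c hσ hγ,
    linearAssignment_frame b c hσ] at hx
  set r := ∑ j, w j / α * q j - (p₀ + ∑ j, w j / α * q₀ j) with hr
  have e : α * (p - p₀) + ∑ j, w j * (q j - q₀ j) = α * (p + r) := by
    rw [hr, mul_add, mul_sub, mul_sub, mul_add, Finset.mul_sum, Finset.mul_sum]
    simp_rw [mul_sub, Finset.sum_sub_distrib, ← mul_assoc, mul_div_cancel₀ _ hα]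
    ring
  rw [e] at hx
  rcases lt_or_gt_of_ne hα with h | h
  · rw [if_neg (not_lt.mpr h.le)] at hx
    by_cases h1 : 0 ≤ p <;> by_cases h2 : 0 ≤ α * (p + r) <;> simp [h1, h2] at hx
    · have : p + r ≤ 0 := by nlinarith
      rw [abs_of_nonneg h1]; exact (by linarith : p ≤ -r).trans (neg_le_abs r)
    · have : 0 < p + r := by nlinarith
      rw [abs_of_neg (not_le.mp h1)]; exact (by linarith : -p ≤ r).trans (le_abs_self r)
  · rw [if_pos h] at hx
    by_cases h1 : 0 ≤ p <;> by_cases h2 : 0 ≤ α * (p + r) <;> simp [h1, h2] at hx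
    · have : p + r < 0 := by nlinarith
      rw [abs_of_nonneg h1]; exact (by linarith : p ≤ -r).trans (neg_le_abs r)
    · have : 0 ≤ p + r := by nlinarith
      rw [abs_of_neg (not_le.mp h1)]; exact (by linarith : -p ≤ r).trans (le_abs_self r)

end Reduction

/-! ### One-dimensional Gaussian estimates -/

section Gaussian

theorem lintegral_exp_mul_sq_gaussianReal {t : ℝ} (ht : t < 1 / 2) :
    ∫⁻ x, ENNReal.ofReal (Real.exp (t * x ^ 2)) ∂(gaussianReal 0 1) =
      ENNReal.ofReal (1 / Real.sqrt (1 - 2 * t)) := by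
  rw [gaussianReal_of_var_ne_zero _ one_ne_zero,
    lintegral_withDensity_eq_lintegral_mul _ (measurable_gaussianPDF _ _) (by fun_prop)]
  have hb : 0 < 1 / 2 - t := by linarith
  have e : ∀ x : ℝ, (gaussianPDF 0 1 * fun x => ENNReal.ofReal (Real.exp (t * x ^ 2))) x =
      ENNReal.ofReal ((Real.sqrt (2 * Real.pi))⁻¹ * Real.exp (-(1 / 2 - t) * x ^ 2)) := by
    intro x
    simp only [Pi.mul_apply, gaussianPDF, gaussianPDFReal, sub_zero, NNReal.coe_one, mul_one]
    rw [← ENNReal.ofReal_mul (by positivity), mul_assoc, ← Real.exp_add]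
    congr 3
    ring
  simp_rw [e]
  rw [← ofReal_integral_eq_lintegral_ofReal ((integrable_exp_neg_mul_sq hb).const_mul _)
    (ae_of_all _ fun x => by positivity), integral_const_mul, integral_gaussian]
  congr 1
  rw [← Real.sqrt_inv, ← Real.sqrt_mul (by positivity), one_div (Real.sqrt _), ← Real.sqrt_inv]
  congr 1
  have : (1 - 2 * t) ≠ 0 := by linarith
  field_simp

theorem gaussianReal_eq_map_std (v : NNReal) :
    gaussianReal 0 v = (gaussianReal 0 1).map (fun x => Real.sqrt v * x) := by
  rw [gaussianReal_map_const_mul]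
  simp only [mul_zero, mul_one]
  congr 1
  ext
  simp

theorem lintegral_exp_mul_sq_le {t : ℝ} (ht0 : 0 ≤ t) (ht : t < 1 / 2) {v : NNReal} (hv : v ≤ 1) :
    ∫⁻ x, ENNReal.ofReal (Real.exp (t * x ^ 2)) ∂(gaussianReal 0 v) ≤
      ENNReal.ofReal (1 / Real.sqrt (1 - 2 * t)) := by
  rw [gaussianReal_eq_map_std, lintegral_map (by fun_prop) (by fun_prop),
    ← lintegral_exp_mul_sq_gaussianReal ht]
  refine lintegral_mono fun x => ENNReal.ofReal_le_ofReal (Real.exp_le_exp.mpr ?_)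
  rw [mul_pow, Real.sq_sqrt v.coe_nonneg]
  have : (v : ℝ) * x ^ 2 ≤ 1 * x ^ 2 := by gcongr; exact_mod_cast hv
  rw [one_mul] at this
  exact mul_le_mul_of_nonneg_left this ht0

theorem integral_sq_gaussianReal (v : NNReal) : ∫ x, x ^ 2 ∂(gaussianReal 0 v) = v := by
  have := variance_fun_id_gaussianReal (μ := 0) (v := v)
  rw [variance_eq_integral (by fun_prop)] at this
  simpa using this

theorem memLp_fun_id_gaussianReal (v : NNReal) : MemLp (fun x => x) 2 (gaussianReal 0 v) :=
  memLp_id_gaussianReal' 2 (by simp)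

/-- Integrate `|x| ≤ x² / (2c) + c / 2` with `c = √v`, which replaces Jensen's inequality. -/
theorem lintegral_abs_gaussianReal_le (v : NNReal) :
    ∫⁻ x, ENNReal.ofReal |x| ∂(gaussianReal 0 v) ≤ ENNReal.ofReal (Real.sqrt v) := by
  rcases eq_or_ne v 0 with rfl | hv
  · simp
  have hc : 0 < Real.sqrt v := Real.sqrt_pos.mpr (by exact_mod_cast pos_iff_ne_zero.mpr hv)
  have hint : Integrable (fun x : ℝ => x ^ 2) (gaussianReal 0 v) :=
    (memLp_fun_id_gaussianReal v).integrable_sq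
  calc ∫⁻ x, ENNReal.ofReal |x| ∂(gaussianReal 0 v)
      ≤ ∫⁻ x, ENNReal.ofReal ((2 * Real.sqrt v)⁻¹ * x ^ 2 + Real.sqrt v / 2)
          ∂(gaussianReal 0 v) := by
        refine lintegral_mono fun x => ENNReal.ofReal_le_ofReal ?_
        have h1 : 2 * Real.sqrt v * |x| ≤ x ^ 2 + Real.sqrt v ^ 2 := by
          rw [← sq_abs x]; nlinarith [sq_nonneg (|x| - Real.sqrt v)]
        have h2 : (2 * Real.sqrt v)⁻¹ * x ^ 2 + Real.sqrt v / 2 =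
            (x ^ 2 + Real.sqrt v ^ 2) / (2 * Real.sqrt v) := by field_simp
        rw [h2, le_div_iff₀ (by positivity)]
        linarith
    _ = ENNReal.ofReal (Real.sqrt v) := by
        have hi : Integrable (fun x : ℝ => (2 * Real.sqrt v)⁻¹ * x ^ 2 + Real.sqrt v / 2)
          (gaussianReal 0 v) := (hint.const_mul _).add (integrable_const _)
        rw [← ofReal_integral_eq_lintegral_ofReal hi (ae_of_all _ fun x => by positivity),
          integral_add (hint.const_mul _) (integrable_const _), integral_const_mul,
          integral_sq_gaussianReal]
        congr 1
        simp only [integral_const, probReal_univ, one_smul]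
        nth_rw 2 [← Real.sq_sqrt v.coe_nonneg]
        field_simp
        ring

theorem gaussianReal_Icc_le {A B C : ℝ} (hC : 0 ≤ C)
    (h : ∀ x ∈ Set.Icc A B, gaussianPDFReal 0 1 x ≤ C) :
    gaussianReal 0 1 (Set.Icc A B) ≤ ENNReal.ofReal (C * (B - A)) := by
  rw [gaussianReal_apply _ one_ne_zero]
  calc ∫⁻ x in Set.Icc A B, gaussianPDF 0 1 x
      ≤ ∫⁻ _ in Set.Icc A B, ENNReal.ofReal C :=
        setLIntegral_mono measurable_const fun x hx => ENNReal.ofReal_le_ofReal (h x hx)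
    _ = _ := by
        rw [setLIntegral_const, Real.volume_Icc, ENNReal.ofReal_mul hC]

theorem gaussianPDFReal_std_le (x : ℝ) :
    gaussianPDFReal 0 1 x ≤ 1 / 2 * Real.exp (-x ^ 2 / 2) := by
  simp only [gaussianPDFReal, NNReal.coe_one, mul_one, sub_zero]
  gcongr
  rw [one_div]
  refine inv_anti₀ (by norm_num) (Real.le_sqrt_of_sq_le ?_)
  nlinarith [Real.pi_gt_three]

/-- The probability that a unit-variance Gaussian with mean `±γ` falls in `[-R, R]`. -/
theorem gaussianReal_abs_add_le {γ R : ℝ} (hγ : 0 < γ) (hR : 0 ≤ R) (s : Bool) :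
    gaussianReal 0 1 {a | |γ * labelSign s + a| ≤ R} ≤
      ENNReal.ofReal (2 / max 1 γ * R) := by
  have hset : {a : ℝ | |γ * labelSign s + a| ≤ R} =
      Set.Icc (-R - γ * labelSign s) (R - γ * labelSign s) := by
    ext a
    simp only [Set.mem_ofPred_eq, Set.mem_Icc, abs_le]
    constructor <;> rintro ⟨h1, h2⟩ <;> constructor <;> linarith
  rcases le_total γ 1 with h1 | h1
  · rw [max_eq_left h1, hset]
    refine (gaussianReal_Icc_le (C := 1 / 2) (by norm_num) fun x _ => ?_).trans
      (ENNReal.ofReal_le_ofReal ?_)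
    · refine (gaussianPDFReal_std_le x).trans ?_
      have : Real.exp (-x ^ 2 / 2) ≤ 1 := Real.exp_le_one_iff.mpr (by nlinarith [sq_nonneg x])
      linarith
    · linarith
  · rw [max_eq_right h1]
    -- For `R ≥ γ / 2` the right side is at least `1`. Otherwise the interval keeps distance `γ / 2`
    -- from the origin, where the density is at most `exp (-γ² / 8) / 2 ≤ 1 / γ`.
    rcases le_total (γ / 2) R with h2 | h2
    · refine prob_le_one.trans ?_
      rw [ENNReal.one_le_ofReal, div_mul_eq_mul_div, le_div_iff₀ hγ]
      linarith
    · rw [hset]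
      refine (gaussianReal_Icc_le (C := 1 / 2 * Real.exp (-γ ^ 2 / 8)) (by positivity)
        fun x hx => ?_).trans (ENNReal.ofReal_le_ofReal ?_)
      · refine (gaussianPDFReal_std_le x).trans ?_
        have hx2 : γ / 2 ≤ |x| := by
          rw [← hset] at hx
          have h3 : |γ * labelSign s| = γ := by rw [abs_mul, abs_labelSign, mul_one, abs_of_pos hγ]
          have h4 : |γ * labelSign s| ≤ |γ * labelSign s + x| + |x| := by
            have := abs_sub (γ * labelSign s + x) x
            rwa [add_sub_cancel_right] at this
          have h5 : |γ * labelSign s + x| ≤ R := hx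
          linarith
        have := mul_self_le_mul_self (by positivity) hx2
        have h6 : Real.exp (-x ^ 2 / 2) ≤ Real.exp (-γ ^ 2 / 8) := by
          rw [← sq_abs x]
          exact Real.exp_le_exp.mpr (by nlinarith)
        linarith
      · have h3 : γ / 2 ≤ Real.exp (γ ^ 2 / 8) := by
          have := Real.add_one_le_exp (γ ^ 2 / 8)
          nlinarith [sq_nonneg (γ - 2)]
        have h4 : Real.exp (-γ ^ 2 / 8) ≤ 2 / γ := by
          rw [neg_div, Real.exp_neg, ← inv_div γ 2]
          exact inv_anti₀ (by positivity) h3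
        have := mul_le_mul_of_nonneg_right h4 hR
        linarith

end Gaussian

/-! ### Linear functionals of the noise -/

section Noise

variable {m : ℕ}

theorem map_linear_noiseMeasure (α : ℝ) (w : Fin m → ℝ) :
    (noiseMeasure m).map (fun z => α * z.1 + ∑ j, w j * z.2 j) =
      gaussianReal 0 (Real.toNNReal (α ^ 2 + ∑ j, w j ^ 2)) := by
  set b := EuclideanSpace.basisFun (Fin (m + 1)) ℝ
  set L : StrongDual ℝ (EuclideanSpace ℝ (Fin (m + 1))) := innerSL ℝ (frame b α w) with hL
  have h1 : (fun z : ℝ × (Fin m → ℝ) => α * z.1 + ∑ j, w j * z.2 j) =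
      L ∘ fun z => frame b z.1 z.2 := by
    ext z
    simp [hL, inner_frame_frame]
  rw [h1, ← Measure.map_map (by fun_prop) (by fun_prop), map_frame,
    IsGaussian.map_eq_gaussianReal, integral_strongDual_stdGaussian, variance_dual_stdGaussian]
  congr 2
  rw [hL, innerSL_apply_norm, ← real_inner_self_eq_norm_sq, inner_frame_frame]
  simp [sq]

theorem lintegral_comp_linear_noiseMeasure (α : ℝ) (w : Fin m → ℝ) {f : ℝ → ℝ≥0∞}
    (hf : Measurable f) :
    ∫⁻ z, f (α * z.1 + ∑ j, w j * z.2 j) ∂(noiseMeasure m) =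
      ∫⁻ x, f x ∂(gaussianReal 0 (Real.toNNReal (α ^ 2 + ∑ j, w j ^ 2))) := by
  rw [← map_linear_noiseMeasure, lintegral_map hf (by fun_prop)]

theorem lintegral_exp_linear_sq_le {t : ℝ} (ht0 : 0 ≤ t) (ht : t < 1 / 2) {α : ℝ} {w : Fin m → ℝ}
    (hw : α ^ 2 + ∑ j, w j ^ 2 ≤ 1) :
    ∫⁻ z, ENNReal.ofReal (Real.exp (t * (α * z.1 + ∑ j, w j * z.2 j) ^ 2)) ∂(noiseMeasure m) ≤
      ENNReal.ofReal (1 / Real.sqrt (1 - 2 * t)) := by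
  rw [lintegral_comp_linear_noiseMeasure α w
    (f := fun x => ENNReal.ofReal (Real.exp (t * x ^ 2))) (by fun_prop)]
  exact lintegral_exp_mul_sq_le ht0 ht (by simpa using hw)

/-- Markov's inequality for `exp (3x² / 8)`. The exponent `3 / 8` makes `1 - 2t = 1 / 4`, so the
moment is at most `2`. -/
theorem noiseMeasure_linear_ge_le {α : ℝ} {w : Fin m → ℝ} (hw : α ^ 2 + ∑ j, w j ^ 2 ≤ 1) {h : ℝ}
    (hh : 0 ≤ h) :
    noiseMeasure m {z | h ≤ |α * z.1 + ∑ j, w j * z.2 j|} ≤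
      ENNReal.ofReal (2 * Real.exp (-(3 / 8 * h ^ 2))) := by
  have h1 := lintegral_exp_linear_sq_le (t := 3 / 8) (by norm_num) (by norm_num) hw
  have h2 : (1 / Real.sqrt (1 - 2 * (3 / 8)) : ℝ) = 2 := by
    rw [show (1 - 2 * (3 / 8) : ℝ) = (1 / 2) ^ 2 by norm_num, Real.sqrt_sq (by norm_num)]
    norm_num
  rw [h2] at h1
  have hsub : {z : ℝ × (Fin m → ℝ) | h ≤ |α * z.1 + ∑ j, w j * z.2 j|} ⊆
      {z | ENNReal.ofReal (Real.exp (3 / 8 * h ^ 2)) ≤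
        ENNReal.ofReal (Real.exp (3 / 8 * (α * z.1 + ∑ j, w j * z.2 j) ^ 2))} := by
    intro z hz
    simp only [Set.mem_ofPred_eq] at hz ⊢
    refine ENNReal.ofReal_le_ofReal (Real.exp_le_exp.mpr ?_)
    have := mul_self_le_mul_self hh hz
    rw [← sq_abs (α * _ + _)]
    nlinarith
  refine (measure_mono hsub).trans ((meas_ge_le_lintegral_div (by fun_prop)
    (by simp [Real.exp_pos]) (by simp)).trans ?_)
  refine (ENNReal.div_le_div_right h1 _).trans ?_
  rw [← ENNReal.ofReal_div_of_pos (Real.exp_pos _), Real.exp_neg, div_eq_mul_inv]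

/-- The coordinate `a` is independent of `y`. Conditionally on `y` this is the small-interval
estimate with radius `|β · y - τ|`; averaging over `y` replaces `|β · y|` by its mean, at most
`|β|`. -/
theorem latentMeasure_abs_le {γ : ℝ} (hγ : 0 < γ) (β : Fin m → ℝ) (τ : ℝ) :
    latentMeasure m {ω | |γ * labelSign ω.1 + ω.2.1| ≤ |∑ j, β j * ω.2.2 j - τ|} ≤
      ENNReal.ofReal (2 / max 1 γ * (Real.sqrt (∑ j, β j ^ 2) + |τ|)) := by
  have hls : Measurable labelSign := measurable_of_finite _
  have hmeas : MeasurableSet {ω : Latent m |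
      |γ * labelSign ω.1 + ω.2.1| ≤ |∑ j, β j * ω.2.2 j - τ|} := by
    apply measurableSet_le
    · exact ((hls.comp measurable_fst).const_mul _ |>.add
        (measurable_fst.comp measurable_snd)).abs
    · fun_prop
  have hκ : 0 ≤ 2 / max 1 γ := by positivity
  have key : ∀ s : Bool, noiseMeasure m {z | |γ * labelSign s + z.1| ≤ |∑ j, β j * z.2 j - τ|} ≤
      ENNReal.ofReal (2 / max 1 γ * (Real.sqrt (∑ j, β j ^ 2) + |τ|)) := by
    intro s
    have hms : MeasurableSet {z : ℝ × (Fin m → ℝ) |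
        |γ * labelSign s + z.1| ≤ |∑ j, β j * z.2 j - τ|} :=
      measurableSet_le (by fun_prop) (by fun_prop)
    have hE := lintegral_comp_linear_noiseMeasure 0 β
      (f := fun x => ENNReal.ofReal |x|) (by fun_prop)
    simp only [zero_mul, zero_add] at hE
    have hbound : ∫⁻ z, ENNReal.ofReal |∑ j, β j * z.2 j| ∂(noiseMeasure m) ≤
        ENNReal.ofReal (Real.sqrt (∑ j, β j ^ 2)) := by
      rw [hE]
      refine (lintegral_abs_gaussianReal_le _).trans_eq ?_
      rw [Real.coe_toNNReal _ (by positivity)]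
      simp
    calc noiseMeasure m {z | |γ * labelSign s + z.1| ≤ |∑ j, β j * z.2 j - τ|}
        = ∫⁻ y, gaussianReal 0 1 {a | |γ * labelSign s + a| ≤ |∑ j, β j * y j - τ|}
            ∂(Measure.pi fun _ : Fin m => gaussianReal 0 1) := by
          rw [noiseMeasure, Measure.prod_apply_symm hms]
          rfl
      -- The integral over `y` is read as one over the whole noise vector, so that the law of `β ·
      -- y` is available with first coefficient `0`.
      _ = ∫⁻ z, gaussianReal 0 1 {a | |γ * labelSign s + a| ≤ |∑ j, β j * z.2 j - τ|}
            ∂(noiseMeasure m) := by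
          have h := (measurePreserving_snd (μ := gaussianReal 0 1)
            (ν := Measure.pi fun _ : Fin m => gaussianReal 0 1))
          refine (h.lintegral_comp (f := fun y =>
            gaussianReal 0 1 {a | |γ * labelSign s + a| ≤ |∑ j, β j * y j - τ|}) ?_).symm
          exact measurable_measure_prodMk_right hms
      _ ≤ ∫⁻ z, ENNReal.ofReal (2 / max 1 γ) *
            (ENNReal.ofReal |∑ j, β j * z.2 j| + ENNReal.ofReal |τ|) ∂(noiseMeasure m) := by
          refine lintegral_mono fun z => ?_
          refine (gaussianReal_abs_add_le hγ (abs_nonneg _) s).trans ?_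
          rw [← ENNReal.ofReal_add (abs_nonneg _) (abs_nonneg _), ← ENNReal.ofReal_mul hκ]
          exact ENNReal.ofReal_le_ofReal (mul_le_mul_of_nonneg_left (abs_sub _ _) hκ)
      _ = ENNReal.ofReal (2 / max 1 γ) *
            (∫⁻ z, ENNReal.ofReal |∑ j, β j * z.2 j| ∂(noiseMeasure m) + ENNReal.ofReal |τ|) := by
          rw [lintegral_const_mul _ (by fun_prop), lintegral_add_right _ measurable_const]
          simp
      _ ≤ _ := by
          rw [ENNReal.ofReal_mul hκ, ENNReal.ofReal_add (Real.sqrt_nonneg _) (abs_nonneg _)]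
          gcongr
  rw [← lintegral_indicator_one hmeas, lintegral_latentMeasure (measurable_one.indicator hmeas)]
  have e : ∀ s : Bool, ∫⁻ z, ({ω : Latent m | |γ * labelSign ω.1 + ω.2.1| ≤
      |∑ j, β j * ω.2.2 j - τ|}).indicator 1 (s, z) ∂(noiseMeasure m) ≤
      ENNReal.ofReal (2 / max 1 γ * (Real.sqrt (∑ j, β j ^ 2) + |τ|)) := by
    intro s
    refine le_trans (le_of_eq ?_) (key s)
    rw [← lintegral_indicator_one (measurableSet_le (by fun_prop) (by fun_prop))]
    rfl
  refine (add_le_add (mul_le_mul_right (e true) _) (mul_le_mul_right (e false) _)).trans_eq ?_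
  rw [← add_mul, one_div, ENNReal.inv_two_add_inv_two, one_mul]

end Noise

/-! ### Empirical means: Chernoff and second-moment bounds -/

section Sample

variable {Ω : Type*} [MeasurableSpace Ω] (μ : Measure Ω) [IsProbabilityMeasure μ] {n : ℕ}

theorem measurable_avg {f : Ω → ℝ} (hf : Measurable f) :
    Measurable fun ω : Fin n → Ω => avg fun i => f (ω i) := by
  unfold avg
  exact (Finset.measurable_sum _ fun i _ => hf.comp (measurable_pi_apply i)).const_mul _

/-- Chernoff's bound for the empirical mean. -/
theorem measure_avg_ge_le (hn : n ≠ 0) {f : Ω → ℝ} (hf : Measurable f) {h t : ℝ} (ht : 0 < t)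
    {C : ℝ} (hC0 : 0 ≤ C)
    (hC : ∫⁻ x, ENNReal.ofReal (Real.exp (t * f x)) ∂μ ≤ ENNReal.ofReal (C * Real.exp (t * h))) :
    Measure.pi (fun _ : Fin n => μ) {ω | h ≤ avg fun i => f (ω i)} ≤ ENNReal.ofReal (C ^ n) := by
  have hn' : (0 : ℝ) < n := by exact_mod_cast Nat.pos_of_ne_zero hn
  have hE : ∫⁻ x, ENNReal.ofReal (Real.exp (t * (f x - h))) ∂μ ≤ ENNReal.ofReal C := by
    have : ∀ x, ENNReal.ofReal (Real.exp (t * (f x - h))) =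
        ENNReal.ofReal (Real.exp (-(t * h))) * ENNReal.ofReal (Real.exp (t * f x)) := by
      intro x
      rw [← ENNReal.ofReal_mul (Real.exp_nonneg _), ← Real.exp_add]
      congr 2; ring
    simp_rw [this]
    rw [lintegral_const_mul _ (by fun_prop)]
    refine (mul_le_mul_right hC _).trans_eq ?_
    rw [← ENNReal.ofReal_mul (Real.exp_nonneg _), mul_comm C, ← mul_assoc, ← Real.exp_add]
    simp
  have hsub : {ω : Fin n → Ω | h ≤ avg fun i => f (ω i)} ⊆
      {ω | 1 ≤ ∏ i, ENNReal.ofReal (Real.exp (t * (f (ω i) - h)))} := by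
    intro ω hω
    simp only [Set.mem_ofPred_eq, avg] at hω ⊢
    rw [← ENNReal.ofReal_prod_of_nonneg fun i _ => Real.exp_nonneg _, ← Real.exp_sum,
      ENNReal.one_le_ofReal, Real.one_le_exp_iff, ← Finset.mul_sum, Finset.sum_sub_distrib]
    rw [inv_mul_eq_div, le_div_iff₀ hn'] at hω
    refine mul_nonneg ht.le ?_
    simp only [Finset.sum_const, Finset.card_univ, Fintype.card_fin, nsmul_eq_mul]
    linarith
  refine (measure_mono hsub).trans ?_
  have hmp : Measurable fun ω : Fin n → Ω =>
      ∏ i, ENNReal.ofReal (Real.exp (t * (f (ω i) - h))) :=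
    Finset.measurable_prod _ fun i _ => by fun_prop
  have h1 := mul_meas_ge_le_lintegral (μ := Measure.pi (fun _ : Fin n => μ)) hmp 1
  rw [one_mul] at h1
  refine h1.trans ?_
  rw [lintegral_pi_prod (fun _ => μ) (fun _ x => ENNReal.ofReal (Real.exp (t * (f x - h))))
    (fun _ => by fun_prop), Finset.prod_const, Finset.card_univ, Fintype.card_fin,
    ENNReal.ofReal_pow hC0]
  gcongr

/-- The expected Euclidean norm of the empirical mean of centred variables. -/
theorem lintegral_sqrt_sum_avg_sq_le (hn : n ≠ 0) {ι : Type*} [Fintype ι] {f : ι → Ω → ℝ}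
    (hf : ∀ j, MemLp (f j) 2 μ) (h0 : ∀ j, ∫ x, f j x ∂μ = 0) {V : ℝ} (hV : 0 < V)
    (h2 : ∀ j, ∫ x, f j x ^ 2 ∂μ ≤ V) :
    ∫⁻ ω, ENNReal.ofReal (Real.sqrt (∑ j, (avg fun i => f j (ω i)) ^ 2))
        ∂(Measure.pi fun _ : Fin n => μ) ≤
      ENNReal.ofReal (Real.sqrt (Fintype.card ι * V / n)) := by
  have hn' : (0 : ℝ) < n := by exact_mod_cast Nat.pos_of_ne_zero hn
  rcases isEmpty_or_nonempty ι with hι | hι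
  · simp
  set P := Measure.pi fun _ : Fin n => μ
  have hS : ∀ j, (fun ω : Fin n → Ω => avg fun i => f j (ω i)) =
      fun ω => (n : ℝ)⁻¹ * (∑ i, fun ω : Fin n → Ω => f j (ω i)) ω := by
    intro j; ext ω; simp [avg]
  have hcomp : ∀ j (i : Fin n), MemLp (fun ω : Fin n → Ω => f j (ω i)) 2 P := fun j i =>
    (hf j).comp_measurePreserving (measurePreserving_eval _ i)
  have hmem : ∀ j, MemLp (fun ω : Fin n → Ω => avg fun i => f j (ω i)) 2 P := by
    intro j
    rw [hS]
    exact (memLp_finsetSum' _ fun i _ => hcomp j i).const_mul _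
  have hmean : ∀ j, ∫ ω, (avg fun i => f j (ω i)) ∂P = 0 := by
    intro j
    simp only [avg]
    rw [integral_const_mul, integral_finsetSum _ fun i _ => (hcomp j i).integrable one_le_two]
    have : ∀ i : Fin n, ∫ ω, f j (ω i) ∂P = 0 := by
      intro i
      rw [← h0 j]
      have hmp := measurePreserving_eval (fun _ : Fin n => μ) i
      have h1 := integral_map (μ := P) (φ := Function.eval i) (f := f j)
        (measurable_pi_apply i).aemeasurable (by rw [hmp.map_eq]; exact (hf j).1)
      rw [hmp.map_eq] at h1
      exact h1.symm
    simp [this]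
  have hvar : ∀ j, ∫ ω, (avg fun i => f j (ω i)) ^ 2 ∂P ≤ V / n := by
    intro j
    have h3 := variance_of_integral_eq_zero (hmem j).1.aemeasurable (hmean j)
    have h4 : ProbabilityTheory.variance (fun ω : Fin n → Ω => avg fun i => f j (ω i)) P =
        (n : ℝ)⁻¹ ^ 2 * (n * ∫ x, f j x ^ 2 ∂μ) := by
      rw [hS, variance_const_mul, variance_sum_pi (X := fun _ => f j) (fun _ => hf j)]
      simp [variance_of_integral_eq_zero (hf j).1.aemeasurable (h0 j)]
    have h5 : ∫ ω, (avg fun i => f j (ω i)) ^ 2 ∂P = (n : ℝ)⁻¹ ^ 2 * (n * ∫ x, f j x ^ 2 ∂μ) := by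
      rw [← h4, h3]
    rw [h5, show (n : ℝ)⁻¹ ^ 2 * (n * ∫ x, f j x ^ 2 ∂μ) = (∫ x, f j x ^ 2 ∂μ) / n by
      field_simp]
    exact div_le_div_of_nonneg_right (h2 j) hn'.le
  have hcard : (0 : ℝ) < Fintype.card ι := by exact_mod_cast Fintype.card_pos
  set c := Real.sqrt (Fintype.card ι * V / n) with hc
  have hcpos : 0 < c := Real.sqrt_pos.mpr (by positivity)
  have hc2 : c ^ 2 = Fintype.card ι * V / n := Real.sq_sqrt (by positivity)
  have hint : Integrable (fun ω : Fin n → Ω => ∑ j, (avg fun i => f j (ω i)) ^ 2) P :=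
    integrable_finsetSum _ fun j _ => (hmem j).integrable_sq
  have hi : Integrable (fun ω : Fin n → Ω =>
      (2 * c)⁻¹ * ∑ j, (avg fun i => f j (ω i)) ^ 2 + c / 2) P :=
    (hint.const_mul _).add (integrable_const _)
  -- AM-GM linearizes the square root at `c`, the square root of the bound for the expected squared
  -- norm.
  calc _ ≤ ∫⁻ ω, ENNReal.ofReal ((2 * c)⁻¹ * ∑ j, (avg fun i => f j (ω i)) ^ 2 + c / 2) ∂P := by
        refine lintegral_mono fun ω => ENNReal.ofReal_le_ofReal ?_
        set G := ∑ j, (avg fun i => f j (ω i)) ^ 2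
        have hG : 0 ≤ G := by positivity
        have h1 : 2 * c * Real.sqrt G ≤ G + c ^ 2 := by
          nlinarith [sq_nonneg (Real.sqrt G - c), Real.sq_sqrt hG]
        have h2 : (2 * c)⁻¹ * G + c / 2 = (G + c ^ 2) / (2 * c) := by field_simp
        rw [h2, le_div_iff₀ (by positivity)]
        linarith
    _ ≤ ENNReal.ofReal c := by
        rw [← ofReal_integral_eq_lintegral_ofReal hi (ae_of_all _ fun ω => by positivity)]
        refine ENNReal.ofReal_le_ofReal ?_
        rw [integral_add (hint.const_mul _) (integrable_const _), integral_const_mul,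
          integral_finsetSum _ fun j _ => (hmem j).integrable_sq]
        simp only [integral_const, probReal_univ, one_smul]
        have h6 : ∑ j, ∫ ω, (avg fun i => f j (ω i)) ^ 2 ∂P ≤ c ^ 2 := by
          refine (Finset.sum_le_sum fun j _ => hvar j).trans_eq ?_
          rw [hc2, Finset.sum_const, Finset.card_univ, nsmul_eq_mul, mul_div_assoc]
        have h7 := mul_le_mul_of_nonneg_left h6 (inv_nonneg.mpr (by positivity : 0 ≤ 2 * c))
        have h8 : (2 * c)⁻¹ * c ^ 2 = c / 2 := by field_simp
        linarith

theorem lintegral_abs_avg_le (hn : n ≠ 0) {f : Ω → ℝ}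
    (hf : MemLp f 2 μ) (h0 : ∫ x, f x ∂μ = 0) {V : ℝ} (hV : 0 < V)
    (h2 : ∫ x, f x ^ 2 ∂μ ≤ V) :
    ∫⁻ ω, ENNReal.ofReal |avg fun i => f (ω i)| ∂(Measure.pi fun _ : Fin n => μ) ≤
      ENNReal.ofReal (Real.sqrt (V / n)) := by
  have := lintegral_sqrt_sum_avg_sq_le μ hn (ι := Unit) (f := fun _ => f) (fun _ => hf)
    (fun _ => h0) hV (fun _ => h2)
  simpa [Real.sqrt_sq_eq_abs] using this

end Sample

/-! ### Moments of the latent variables -/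

section Moments

variable {m : ℕ}

theorem lintegral_snd_latentMeasure {f : ℝ × (Fin m → ℝ) → ℝ≥0∞} (hf : Measurable f) :
    ∫⁻ ω, f ω.2 ∂(latentMeasure m) = ∫⁻ z, f z ∂(noiseMeasure m) := by
  rw [lintegral_latentMeasure (by fun_prop), ← add_mul, one_div, ENNReal.inv_two_add_inv_two,
    one_mul]

theorem memLp_mul_latentMeasure {φ : Bool → ℝ} {ψ : ℝ → ℝ} {χ : (Fin m → ℝ) → ℝ}
    (hψ : MemLp ψ 2 (gaussianReal 0 1))
    (hχ : MemLp χ 2 (Measure.pi fun _ : Fin m => gaussianReal 0 1)) :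
    MemLp (fun ω : Latent m => φ ω.1 * (ψ ω.2.1 * χ ω.2.2)) 2 (latentMeasure m) := by
  have hφ : Integrable (fun s => φ s ^ 2) labelMeasure := Integrable.of_finite
  have hm1 : AEStronglyMeasurable φ labelMeasure := (measurable_of_finite φ).aestronglyMeasurable
  refine (memLp_two_iff_integrable_sq ?_).mpr ?_
  · exact hm1.comp_fst.mul (hψ.1.comp_fst.mul hχ.1.comp_snd).comp_snd
  · have := hφ.mul_prod (hψ.integrable_sq.mul_prod hχ.integrable_sq)
    refine this.congr (ae_of_all _ fun ω => ?_)
    simp only [mul_pow]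

theorem integral_mul_latentMeasure (φ : Bool → ℝ) (ψ : ℝ → ℝ) (χ : (Fin m → ℝ) → ℝ) :
    ∫ ω, φ ω.1 * (ψ ω.2.1 * χ ω.2.2) ∂(latentMeasure m) =
      (∫ s, φ s ∂labelMeasure) * ((∫ a, ψ a ∂(gaussianReal 0 1)) *
        ∫ y, χ y ∂(Measure.pi fun _ : Fin m => gaussianReal 0 1)) := by
  rw [latentMeasure, integral_prod_mul (μ := labelMeasure) φ
    (fun z : ℝ × (Fin m → ℝ) => ψ z.1 * χ z.2), noiseMeasure, integral_prod_mul]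

theorem integral_labelSign : ∫ s, labelSign s ∂labelMeasure = 0 := by
  have h : ∀ s, Integrable labelSign ((1 / 2 : ℝ≥0∞) • Measure.dirac s) := fun s =>
    Integrable.smul_measure Integrable.of_finite (by simp)
  rw [labelMeasure, integral_add_measure (h _) (h _)]
  simp [labelSign]

theorem integral_sq_mul_latentMeasure (φ : Bool → ℝ) (ψ : ℝ → ℝ) (χ : (Fin m → ℝ) → ℝ) :
    ∫ ω, (φ ω.1 * (ψ ω.2.1 * χ ω.2.2)) ^ 2 ∂(latentMeasure m) =
      (∫ s, φ s ^ 2 ∂labelMeasure) * ((∫ a, ψ a ^ 2 ∂(gaussianReal 0 1)) *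
        ∫ y, χ y ^ 2 ∂(Measure.pi fun _ : Fin m => gaussianReal 0 1)) := by
  simp_rw [mul_pow]
  exact integral_mul_latentMeasure (fun s => φ s ^ 2) (fun a => ψ a ^ 2) (fun y => χ y ^ 2)

theorem memLp_eval_gaussian (j : Fin m) :
    MemLp (fun y : Fin m → ℝ => y j) 2 (Measure.pi fun _ : Fin m => gaussianReal 0 1) :=
  (memLp_fun_id_gaussianReal 1).comp_measurePreserving (measurePreserving_eval _ j)

theorem integral_eval_gaussian (f : ℝ → ℝ) (hf : Measurable f) (j : Fin m) :
    ∫ y, f (y j) ∂(Measure.pi fun _ : Fin m => gaussianReal 0 1) = ∫ x, f x ∂(gaussianReal 0 1) := by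
  have hmp := measurePreserving_eval (fun _ : Fin m => gaussianReal 0 1) j
  have h1 := integral_map (μ := Measure.pi fun _ : Fin m => gaussianReal 0 1)
    (φ := Function.eval j) (f := f) (measurable_pi_apply j).aemeasurable hf.aestronglyMeasurable
  rw [hmp.map_eq] at h1
  exact h1.symm

/-- A crude route to the second moment of `x² - 1`: an exponential moment is already known, and only
some absolute constant is needed. -/
theorem sq_sub_one_sq_le (x : ℝ) : (x ^ 2 - 1) ^ 2 ≤ 32 * Real.exp (1 / 4 * x ^ 2) := by
  have h := Real.quadratic_le_exp_of_nonneg (x := 1 / 4 * x ^ 2) (by positivity)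
  nlinarith [sq_nonneg x]

theorem integrable_exp_sq_gaussianReal :
    Integrable (fun x => Real.exp (1 / 4 * x ^ 2)) (gaussianReal 0 1) := by
  refine ⟨by fun_prop, ?_⟩
  rw [hasFiniteIntegral_iff_ofReal (ae_of_all _ fun x => Real.exp_nonneg _),
    lintegral_exp_mul_sq_gaussianReal (by norm_num)]
  exact ENNReal.ofReal_lt_top

theorem memLp_sq_sub_one : MemLp (fun x => x ^ 2 - 1) 2 (gaussianReal 0 1) := by
  refine (memLp_two_iff_integrable_sq (by fun_prop)).mpr ?_
  refine Integrable.mono' (integrable_exp_sq_gaussianReal.const_mul 32) (by fun_prop)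
    (ae_of_all _ fun x => ?_)
  rw [Real.norm_of_nonneg (sq_nonneg _)]
  exact sq_sub_one_sq_le x

theorem integral_sq_sub_one : ∫ x, (x ^ 2 - 1) ∂(gaussianReal 0 1) = 0 := by
  rw [integral_sub (memLp_fun_id_gaussianReal 1).integrable_sq (integrable_const _),
    integral_sq_gaussianReal]
  simp

theorem integral_sq_sub_one_sq_le : ∫ x, (x ^ 2 - 1) ^ 2 ∂(gaussianReal 0 1) ≤ 64 := by
  have h1 : ∫ x, Real.exp (1 / 4 * x ^ 2) ∂(gaussianReal 0 1) = 1 / Real.sqrt (1 / 2) := by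
    rw [integral_eq_lintegral_of_nonneg_ae (ae_of_all _ fun x => Real.exp_nonneg _) (by fun_prop),
      lintegral_exp_mul_sq_gaussianReal (by norm_num),
      ENNReal.toReal_ofReal (by positivity)]
    norm_num
  calc _ ≤ ∫ x, 32 * Real.exp (1 / 4 * x ^ 2) ∂(gaussianReal 0 1) :=
        integral_mono memLp_sq_sub_one.integrable_sq
          (integrable_exp_sq_gaussianReal.const_mul 32) sq_sub_one_sq_le
    _ ≤ 64 := by
        rw [integral_const_mul, h1]
        have : (1 / 2 : ℝ) ≤ Real.sqrt (1 / 2) := Real.le_sqrt_of_sq_le (by norm_num)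
        have h2 : 1 / Real.sqrt (1 / 2) ≤ 2 := by
          rw [div_le_iff₀ (by linarith)]; linarith
        linarith

end Moments

/-! ### Expected size of the sample statistics -/

section Statistics

variable {m n : ℕ}

/-- The law of a latent sample. -/
def latentSample (m n : ℕ) : Measure (Fin n → Latent m) := Measure.pi fun _ => latentMeasure m

instance : IsProbabilityMeasure (latentSample m n) := by unfold latentSample; infer_instance

theorem lintegral_abs_avg_prod_le (hn : n ≠ 0) (φ : Bool → ℝ) (ψ : ℝ → ℝ)
    (hψ : MemLp ψ 2 (gaussianReal 0 1))
    (h0 : (∫ s, φ s ∂labelMeasure) = 0 ∨ (∫ a, ψ a ∂(gaussianReal 0 1)) = 0)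
    (hφ2 : ∀ s, φ s ^ 2 = 1) {V : ℝ} (hV : 0 < V) (hψ2 : ∫ a, ψ a ^ 2 ∂(gaussianReal 0 1) ≤ V) :
    ∫⁻ ω, ENNReal.ofReal |avg fun i => φ (ω i).1 * ψ (ω i).2.1| ∂(latentSample m n) ≤
      ENNReal.ofReal (Real.sqrt (V / n)) := by
  have h1 : MemLp (fun _ : Fin m → ℝ => (1 : ℝ)) 2 (Measure.pi fun _ : Fin m => gaussianReal 0 1) :=
    memLp_const 1
  have := lintegral_abs_avg_le (latentMeasure m) hn
    (memLp_mul_latentMeasure (φ := φ) hψ h1) (by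
      rw [integral_mul_latentMeasure φ ψ fun _ => 1]
      rcases h0 with h | h <;> simp [h]) hV (by
      rw [integral_sq_mul_latentMeasure φ ψ fun _ => 1]
      simpa only [hφ2, integral_const, probReal_univ, one_smul, one_mul, one_pow, mul_one,
        NNReal.coe_one] using hψ2)
  simpa [latentSample] using this

theorem lintegral_norm_avg_prod_le (hn : n ≠ 0) (φ : Bool → ℝ) (ψ : ℝ → ℝ)
    (hψ : MemLp ψ 2 (gaussianReal 0 1))
    (hφ2 : ∀ s, φ s ^ 2 = 1) (hψ2 : ∫ a, ψ a ^ 2 ∂(gaussianReal 0 1) ≤ 1) :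
    ∫⁻ ω, ENNReal.ofReal
        (Real.sqrt (∑ j, (avg fun i => φ (ω i).1 * (ψ (ω i).2.1 * (ω i).2.2 j)) ^ 2))
        ∂(latentSample m n) ≤ ENNReal.ofReal (Real.sqrt (m / n)) := by
  have := lintegral_sqrt_sum_avg_sq_le (latentMeasure m) hn (ι := Fin m)
    (f := fun j (ω : Latent m) => φ ω.1 * (ψ ω.2.1 * ω.2.2 j))
    (fun j => memLp_mul_latentMeasure hψ (memLp_eval_gaussian j)) (fun j => by
      rw [integral_mul_latentMeasure φ ψ fun y => y j,
        integral_eval_gaussian (fun x => x) measurable_id]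
      simp) (V := 1) one_pos (fun j => by
      rw [integral_sq_mul_latentMeasure φ ψ fun y => y j,
        integral_eval_gaussian (fun x => x ^ 2) (by fun_prop), integral_sq_gaussianReal]
      simpa only [hφ2, integral_const, probReal_univ, one_smul, one_mul, one_pow, mul_one,
        NNReal.coe_one] using hψ2)
  simpa [latentSample] using this

theorem memLp_const_gaussianReal : MemLp (fun _ => (1 : ℝ)) 2 (gaussianReal 0 1) := memLp_const 1

theorem lintegral_avg_sign_le (hn : n ≠ 0) :
    ∫⁻ ω, ENNReal.ofReal |avg fun i => labelSign (ω i).1| ∂(latentSample m n) ≤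
      ENNReal.ofReal (Real.sqrt (1 / n)) := by
  have := lintegral_abs_avg_prod_le (m := m) hn labelSign (fun _ => 1) memLp_const_gaussianReal
    (Or.inl integral_labelSign) labelSign_sq one_pos (by simp)
  simpa using this

theorem lintegral_avg_coord_le (hn : n ≠ 0) :
    ∫⁻ ω, ENNReal.ofReal |avg fun i => (ω i).2.1| ∂(latentSample m n) ≤
      ENNReal.ofReal (Real.sqrt (1 / n)) := by
  have := lintegral_abs_avg_prod_le (m := m) hn (fun _ => 1) (fun a => a)
    (memLp_fun_id_gaussianReal 1) (Or.inr (by simp)) (by simp) one_pos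
    (by rw [integral_sq_gaussianReal]; simp)
  simpa using this

theorem lintegral_avg_sign_mul_coord_le (hn : n ≠ 0) :
    ∫⁻ ω, ENNReal.ofReal |avg fun i => labelSign (ω i).1 * (ω i).2.1| ∂(latentSample m n) ≤
      ENNReal.ofReal (Real.sqrt (1 / n)) :=
  lintegral_abs_avg_prod_le (m := m) hn labelSign (fun a => a)
    (memLp_fun_id_gaussianReal 1) (Or.inr (by simp)) labelSign_sq one_pos
    (by rw [integral_sq_gaussianReal]; simp)

theorem lintegral_avg_coord_sq_le (hn : n ≠ 0) :
    ∫⁻ ω, ENNReal.ofReal |avg fun i => (ω i).2.1 ^ 2 - 1| ∂(latentSample m n) ≤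
      ENNReal.ofReal (Real.sqrt (64 / n)) := by
  have := lintegral_abs_avg_prod_le (m := m) hn (fun _ => 1) (fun a => a ^ 2 - 1)
    memLp_sq_sub_one (Or.inr integral_sq_sub_one) (by simp) (by norm_num)
    integral_sq_sub_one_sq_le
  simpa using this

theorem lintegral_avg_noise_le (hn : n ≠ 0) :
    ∫⁻ ω, ENNReal.ofReal (Real.sqrt (∑ j, (avg fun i => (ω i).2.2 j) ^ 2))
      ∂(latentSample m n) ≤ ENNReal.ofReal (Real.sqrt (m / n)) := by
  have := lintegral_norm_avg_prod_le (m := m) hn (fun _ => 1) (fun _ => 1)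
    memLp_const_gaussianReal (by simp) (by simp)
  simpa using this

theorem lintegral_avg_sign_mul_noise_le (hn : n ≠ 0) :
    ∫⁻ ω, ENNReal.ofReal (Real.sqrt (∑ j, (avg fun i => labelSign (ω i).1 * (ω i).2.2 j) ^ 2))
      ∂(latentSample m n) ≤ ENNReal.ofReal (Real.sqrt (m / n)) := by
  have := lintegral_norm_avg_prod_le (m := m) hn labelSign (fun _ => 1)
    memLp_const_gaussianReal labelSign_sq (by simp)
  simpa using this

theorem lintegral_avg_coord_mul_noise_le (hn : n ≠ 0) :
    ∫⁻ ω, ENNReal.ofReal (Real.sqrt (∑ j, (avg fun i => (ω i).2.1 * (ω i).2.2 j) ^ 2))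
      ∂(latentSample m n) ≤ ENNReal.ofReal (Real.sqrt (m / n)) := by
  have := lintegral_norm_avg_prod_le (m := m) hn (fun _ => 1) (fun a => a)
    (memLp_fun_id_gaussianReal 1) (by simp) (by rw [integral_sq_gaussianReal]; simp)
  simpa using this

end Statistics

/-! ### Exponential tails of the sample statistics -/

section Tails

variable {m n : ℕ}

theorem measurable_labelSign : Measurable labelSign := measurable_of_finite _

/-- Chernoff with `cosh t ≤ exp (t² / 2)` at the optimal `t = 1 / 4`; the two signs give the factor
`2`. -/
theorem latentSample_avg_sign_ge_le (hn : n ≠ 0) :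
    latentSample m n {ω | 1 / 4 ≤ |avg fun i => labelSign (ω i).1|} ≤
      ENNReal.ofReal (2 * Real.exp (-(n : ℝ) / 32)) := by
  have key : ∀ e : ℝ, e ^ 2 = 1 →
      latentSample m n {ω | 1 / 4 ≤ avg fun i => e * labelSign (ω i).1} ≤
        ENNReal.ofReal (Real.exp (-(n : ℝ) / 32)) := by
    intro e he
    have h := measure_avg_ge_le (latentMeasure m) hn (f := fun ω => e * labelSign ω.1)
      (measurable_labelSign.comp measurable_fst |>.const_mul e) (h := 1 / 4) (t := 1 / 4)
      (by norm_num) (C := Real.exp (-1 / 32)) (Real.exp_nonneg _) ?_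
    · refine h.trans_eq ?_
      rw [← Real.exp_nat_mul]
      congr 2; ring
    · have hm : Measurable fun ω : Latent m =>
          ENNReal.ofReal (Real.exp (1 / 4 * (e * labelSign ω.1))) :=
        (Real.measurable_exp.comp ((measurable_labelSign.comp measurable_fst |>.const_mul e).const_mul
          _)).ennreal_ofReal
      rw [lintegral_latentMeasure hm]
      simp only [lintegral_const, measure_univ, mul_one]
      rw [show (1 / 2 : ℝ≥0∞) = ENNReal.ofReal (1 / 2) by
        rw [ENNReal.ofReal_div_of_pos (by norm_num)]; simp,
        ← ENNReal.ofReal_mul (by norm_num), ← ENNReal.ofReal_mul (by norm_num),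
        ← ENNReal.ofReal_add (by positivity) (by positivity)]
      refine ENNReal.ofReal_le_ofReal ?_
      have h1 := Real.cosh_le_exp_half_sq (1 / 4 * e)
      rw [Real.cosh_eq] at h1
      rw [← Real.exp_add]
      have h2 : (1 / 4 * e) ^ 2 / 2 = -1 / 32 + 1 / 4 * (1 / 4) := by rw [mul_pow, he]; norm_num
      rw [h2] at h1
      simp only [labelSign, if_true, Bool.false_eq_true, if_false, mul_one, mul_neg]
      linarith
  have hsub : {ω : Fin n → Latent m | 1 / 4 ≤ |avg fun i => labelSign (ω i).1|} ⊆
      {ω | 1 / 4 ≤ avg fun i => 1 * labelSign (ω i).1} ∪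
        {ω | 1 / 4 ≤ avg fun i => -1 * labelSign (ω i).1} := by
    intro ω hω
    simp only [Set.mem_ofPred_eq, Set.mem_union, avg, ← Finset.mul_sum, one_mul] at hω ⊢
    rcases le_abs.mp hω with h | h
    · exact Or.inl h
    · right; linarith
  refine (measure_mono hsub).trans ((measure_union_le _ _).trans
    ((add_le_add (key 1 (by norm_num)) (key (-1) (by norm_num))).trans_eq ?_))
  rw [← ENNReal.ofReal_add (by positivity) (by positivity), two_mul]

theorem latentSample_trace_ge_le (hn : n ≠ 0) :
    latentSample m n {ω | 2 * (m + 1 : ℝ) ≤ avg fun i => (ω i).2.1 ^ 2 + ∑ j, (ω i).2.2 j ^ 2} ≤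
      ENNReal.ofReal (Real.exp (-(n : ℝ) / 32)) := by
  have h := measure_avg_ge_le (latentMeasure m) hn
    (f := fun ω => ω.2.1 ^ 2 + ∑ j, ω.2.2 j ^ 2)
    (by fun_prop) (h := 2 * (m + 1)) (t := 1 / 4)
    (by norm_num) (C := Real.exp (-1 / 32)) (Real.exp_nonneg _) ?_
  · refine h.trans_eq ?_
    rw [← Real.exp_nat_mul]
    congr 2; ring
  · rw [lintegral_snd_latentMeasure (f := fun z : ℝ × (Fin m → ℝ) =>
      ENNReal.ofReal (Real.exp (1 / 4 * (z.1 ^ 2 + ∑ j, z.2 j ^ 2)))) (by fun_prop)]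
    have e : ∀ z : ℝ × (Fin m → ℝ),
        ENNReal.ofReal (Real.exp (1 / 4 * (z.1 ^ 2 + ∑ j, z.2 j ^ 2))) =
        ENNReal.ofReal (Real.exp (1 / 4 * z.1 ^ 2)) *
          ∏ j, ENNReal.ofReal (Real.exp (1 / 4 * z.2 j ^ 2)) := by
      intro z
      rw [← ENNReal.ofReal_prod_of_nonneg fun i _ => Real.exp_nonneg _, ← Real.exp_sum,
        ← ENNReal.ofReal_mul (Real.exp_nonneg _), ← Real.exp_add, mul_add, Finset.mul_sum]
    simp_rw [e]
    rw [noiseMeasure, lintegral_prod_mul (f := fun a => ENNReal.ofReal (Real.exp (1 / 4 * a ^ 2)))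
      (g := fun y : Fin m → ℝ => ∏ j, ENNReal.ofReal (Real.exp (1 / 4 * y j ^ 2)))
      (by fun_prop) (Finset.measurable_prod _ fun i _ => by fun_prop).aemeasurable,
      lintegral_pi_prod (fun _ => gaussianReal 0 1)
        (fun _ x => ENNReal.ofReal (Real.exp (1 / 4 * x ^ 2))) (fun _ => by fun_prop),
      Finset.prod_const, lintegral_exp_mul_sq_gaussianReal (by norm_num), Finset.card_univ,
      Fintype.card_fin, ← pow_succ', ← ENNReal.ofReal_pow (by positivity)]
    refine ENNReal.ofReal_le_ofReal ?_
    -- Since `15 / 32 = 1 / 2 - 1 / 32`, each of the `m + 1 ≥ 1` coordinates leaves a surplus of `1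
    -- / 32` against the threshold exponent.
    have h1 : 1 / Real.sqrt (1 - 2 * (1 / 4)) ≤ Real.exp (15 / 32) := by
      have h2 : (1 : ℝ) ≤ Real.exp (15 / 16) * (1 / 2) := by
        have := Real.quadratic_le_exp_of_nonneg (x := 15 / 16) (by norm_num)
        linarith
      rw [div_le_iff₀ (Real.sqrt_pos.mpr (by norm_num))]
      have h3 : Real.exp (15 / 32) = Real.sqrt (Real.exp (15 / 16)) := by
        rw [eq_comm, Real.sqrt_eq_iff_mul_self_eq (Real.exp_nonneg _) (Real.exp_nonneg _),
      ← Real.exp_add]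
        norm_num
      rw [h3, ← Real.sqrt_mul (Real.exp_nonneg _)]
      refine Real.le_sqrt_of_sq_le ?_
      norm_num at h2 ⊢
      linarith
    refine (pow_le_pow_left₀ (by positivity) h1 _).trans ?_
    rw [← Real.exp_nat_mul, ← Real.exp_add]
    refine Real.exp_le_exp.mpr ?_
    push_cast
    have : (0 : ℝ) ≤ m := Nat.cast_nonneg m
    linarith

/-- After squaring, the claim is `1 ≤ exp (2t + 4t²) (1 - 2t)`, and the quadratic lower bound for
the exponential suffices on `[0, 1 / 4]`. -/
theorem one_div_sqrt_le_exp {t : ℝ} (ht0 : 0 ≤ t) (ht : t ≤ 1 / 4) :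
    1 / Real.sqrt (1 - 2 * t) ≤ Real.exp (t + 2 * t ^ 2) := by
  have hpos : 0 < 1 - 2 * t := by linarith
  rw [div_le_iff₀ (Real.sqrt_pos.mpr hpos)]
  have h3 : Real.exp (t + 2 * t ^ 2) = Real.sqrt (Real.exp (2 * t + 4 * t ^ 2)) := by
    rw [eq_comm, Real.sqrt_eq_iff_mul_self_eq (Real.exp_nonneg _) (Real.exp_nonneg _),
      ← Real.exp_add]
    congr 1; ring
  rw [h3, ← Real.sqrt_mul (Real.exp_nonneg _)]
  refine Real.le_sqrt_of_sq_le ?_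
  have h := Real.quadratic_le_exp_of_nonneg (x := 2 * t + 4 * t ^ 2) (by positivity)
  have h1 := mul_le_mul_of_nonneg_right h hpos.le
  refine le_trans ?_ h1
  nlinarith [pow_nonneg ht0 2, pow_nonneg ht0 3, pow_nonneg ht0 4,
    mul_nonneg (pow_nonneg ht0 2) (by linarith : 0 ≤ 1 / 4 - t),
    mul_nonneg (pow_nonneg ht0 3) (by linarith : 0 ≤ 1 / 4 - t),
    mul_nonneg (pow_nonneg ht0 4) (by linarith : 0 ≤ 1 / 4 - t)]

/-- Chernoff at `t = ε / 4`: the moment bound `exp (t + 2t²)` against `exp (t (1 + ε))` leaves `exp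
(-ε² / 8)` per observation. -/
theorem latentSample_linear_sq_ge_le (hn : n ≠ 0) {w : Fin m → ℝ} (hw : ∑ j, w j ^ 2 ≤ 1) {ε : ℝ}
    (hε0 : 0 < ε) (hε : ε ≤ 1) :
    latentSample m n {ω | 1 + ε ≤ avg fun i => (∑ j, w j * (ω i).2.2 j) ^ 2} ≤
      ENNReal.ofReal (Real.exp (-(n * ε ^ 2 / 8))) := by
  have h := measure_avg_ge_le (latentMeasure m) hn
    (f := fun ω => (∑ j, w j * ω.2.2 j) ^ 2)
    (by fun_prop) (h := 1 + ε) (t := ε / 4)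
    (by positivity) (C := Real.exp (-(ε ^ 2 / 8))) (Real.exp_nonneg _) ?_
  · refine h.trans_eq ?_
    rw [← Real.exp_nat_mul]
    congr 2; ring
  · rw [lintegral_snd_latentMeasure (f := fun z : ℝ × (Fin m → ℝ) =>
      ENNReal.ofReal (Real.exp (ε / 4 * (∑ j, w j * z.2 j) ^ 2))) (by fun_prop)]
    have h1 := lintegral_exp_linear_sq_le (t := ε / 4) (by positivity) (by linarith) (α := 0)
      (w := w) (by simpa using hw)
    simp only [zero_mul, zero_add] at h1
    refine h1.trans (ENNReal.ofReal_le_ofReal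
      ((one_div_sqrt_le_exp (by positivity) (by linarith)).trans ?_))
    rw [← Real.exp_add]
    refine Real.exp_le_exp.mpr (le_of_eq (by ring))

end Tails

/-! ### Algebra of empirical averages -/

section Avg

variable {n : ℕ}

theorem avg_add (x y : Fin n → ℝ) : (avg fun i => x i + y i) = avg x + avg y := by
  simp only [avg, Finset.sum_add_distrib, mul_add]

theorem avg_sub (x y : Fin n → ℝ) : (avg fun i => x i - y i) = avg x - avg y := by
  simp only [avg, Finset.sum_sub_distrib, mul_sub]

theorem avg_const_mul (c : ℝ) (x : Fin n → ℝ) : (avg fun i => c * x i) = c * avg x := by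
  simp only [avg, ← Finset.mul_sum]; ring

theorem avg_const (hn : n ≠ 0) (c : ℝ) : (avg fun _ : Fin n => c) = c := by
  have hn' : (n : ℝ) ≠ 0 := by exact_mod_cast hn
  simp [avg, hn']

theorem avg_finsetSum {ι : Type*} [Fintype ι] (x : ι → Fin n → ℝ) :
    (avg fun i => ∑ j, x j i) = ∑ j, avg (x j) := by
  simp only [avg]
  rw [Finset.sum_comm, Finset.mul_sum]

theorem avg_mono {x y : Fin n → ℝ} (h : ∀ i, x i ≤ y i) : avg x ≤ avg y :=
  mul_le_mul_of_nonneg_left (Finset.sum_le_sum fun i _ => h i) (by positivity)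

theorem avg_nonneg {x : Fin n → ℝ} (h : ∀ i, 0 ≤ x i) : 0 ≤ avg x :=
  mul_nonneg (by positivity) (Finset.sum_nonneg fun i _ => h i)

theorem avg_centered_mul (hn : n ≠ 0) (x y : Fin n → ℝ) :
    (avg fun i => (x i - avg x) * (y i - avg y)) = (avg fun i => x i * y i) - avg x * avg y := by
  have : ∀ i, (x i - avg x) * (y i - avg y) =
      x i * y i - (avg y * x i + (avg x * y i - avg x * avg y)) := by intro i; ring
  simp_rw [this]
  rw [avg_sub, avg_add, avg_sub, avg_const_mul, avg_const_mul, avg_const hn]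
  ring

theorem avg_centered_sq (hn : n ≠ 0) (x : Fin n → ℝ) :
    (avg fun i => (x i - avg x) ^ 2) = (avg fun i => x i ^ 2) - avg x ^ 2 := by
  have := avg_centered_mul hn x x
  simpa [sq] using this

theorem avg_centered_sq_le (hn : n ≠ 0) (x : Fin n → ℝ) :
    (avg fun i => (x i - avg x) ^ 2) ≤ avg fun i => x i ^ 2 := by
  rw [avg_centered_sq hn]; linarith [sq_nonneg (avg x)]

theorem sq_avg_le (hn : n ≠ 0) (x : Fin n → ℝ) : avg x ^ 2 ≤ avg fun i => x i ^ 2 := by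
  have := avg_centered_sq hn x
  have h : 0 ≤ avg fun i => (x i - avg x) ^ 2 := avg_nonneg fun i => sq_nonneg _
  linarith

end Avg

/-! ### Discretization of the noise quadratic form -/

section Grid

/-- The points of the grid `{-1, …, -1/K, 0, 1/K, …, 1}`. -/
def gridPoint (K : ℕ) (k : Fin (2 * K + 1)) : ℝ := ((k : ℝ) - K) / K

/-- Rounding is towards zero, so that rounding every coordinate of a unit vector keeps it in the
unit ball. -/
theorem exists_gridPoint {K : ℕ} (hK : 0 < K) {x : ℝ} (hx : |x| ≤ 1) :
    ∃ k, |gridPoint K k| ≤ |x| ∧ |x - gridPoint K k| ≤ 1 / K := by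
  have hK' : (0 : ℝ) < K := by exact_mod_cast hK
  set q := ⌊(K : ℝ) * |x|⌋₊ with hq
  have hq1 : (q : ℝ) ≤ K * |x| := Nat.floor_le (by positivity)
  have hq2 : K * |x| < q + 1 := Nat.lt_floor_add_one _
  have hqK : q ≤ K := by
    have : (q : ℝ) ≤ K := hq1.trans (by nlinarith)
    exact_mod_cast this
  have e1 : |(q : ℝ) / K| ≤ |x| := by
    rw [abs_of_nonneg (by positivity), div_le_iff₀ hK']; linarith
  have e2 : abs (|x| - (q : ℝ) / K) ≤ 1 / K := by
    have h1 : (q : ℝ) / K ≤ |x| := by rw [div_le_iff₀ hK']; linarith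
    rw [abs_of_nonneg (by linarith), sub_le_iff_le_add, ← add_div, le_div_iff₀ hK']
    linarith
  rcases le_total 0 x with h | h
  · refine ⟨⟨K + q, by omega⟩, ?_⟩
    have : gridPoint K ⟨K + q, by omega⟩ = q / K := by simp [gridPoint]
    rw [this]
    rw [abs_of_nonneg h] at e2
    exact ⟨e1, e2⟩
  · refine ⟨⟨K - q, by omega⟩, ?_⟩
    have : gridPoint K ⟨K - q, by omega⟩ = -(q / K) := by
      simp [gridPoint, Nat.cast_sub hqK]; ring
    rw [this, abs_neg]
    refine ⟨e1, ?_⟩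
    rw [abs_of_nonpos h] at e2
    rw [← abs_neg]
    convert e2 using 2
    ring

variable {m n : ℕ}

theorem avg_linear_sq_le (w : Fin m → ℝ) (y : Fin n → Fin m → ℝ) :
    (avg fun i => (∑ j, w j * y i j) ^ 2) ≤ (∑ j, w j ^ 2) * avg fun i => ∑ j, y i j ^ 2 := by
  rw [← avg_const_mul]
  exact avg_mono fun i => Finset.sum_mul_sq_le_sq_mul_sq _ _ _

/-- A bound for a quadratic form on the points of a fine grid controls the form everywhere. -/
theorem quadratic_le_of_grid {K : ℕ} (hK : 0 < K) {y : Fin n → Fin m → ℝ} {T ε r : ℝ}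
    (hr : 0 < r) (hT : (avg fun i => ∑ j, y i j ^ 2) ≤ T)
    (hgrid : ∀ k : Fin m → Fin (2 * K + 1), ∑ j, gridPoint K (k j) ^ 2 ≤ 1 →
      (avg fun i => (∑ j, gridPoint K (k j) * y i j) ^ 2) ≤ 1 + ε) (w : Fin m → ℝ) :
    (avg fun i => (∑ j, w j * y i j) ^ 2) ≤
      ((1 + r) * (1 + ε) + (1 + 1 / r) * (m / K ^ 2 * T)) * ∑ j, w j ^ 2 := by
  have hK' : (0 : ℝ) < K := by exact_mod_cast hK
  have hT0 : 0 ≤ T := le_trans (avg_nonneg fun i => by positivity) hT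
  have unit : ∀ w : Fin m → ℝ, ∑ j, w j ^ 2 = 1 → (avg fun i => (∑ j, w j * y i j) ^ 2) ≤
      (1 + r) * (1 + ε) + (1 + 1 / r) * (m / K ^ 2 * T) := by
    intro w hw
    have hw1 : ∀ j, |w j| ≤ 1 := by
      intro j
      rw [← sq_le_one_iff_abs_le_one, ← hw]
      exact Finset.single_le_sum (f := fun j => w j ^ 2) (fun i _ => sq_nonneg _)
        (Finset.mem_univ j)
    choose k hk1 hk2 using fun j => exists_gridPoint hK (hw1 j)
    have hk : ∑ j, gridPoint K (k j) ^ 2 ≤ 1 := by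
      rw [← hw]
      exact Finset.sum_le_sum fun j _ => sq_le_sq.mpr (hk1 j)
    have hdiff : ∑ j, (w j - gridPoint K (k j)) ^ 2 ≤ m / K ^ 2 := by
      calc ∑ j, (w j - gridPoint K (k j)) ^ 2 ≤ ∑ _j : Fin m, (1 / (K : ℝ)) ^ 2 := by
            refine Finset.sum_le_sum fun j _ => ?_
            rw [← sq_abs]
            exact pow_le_pow_left₀ (abs_nonneg _) (hk2 j) 2
        _ = _ := by simp; ring
    have h1 : (avg fun i => (∑ j, (w j - gridPoint K (k j)) * y i j) ^ 2) ≤ m / K ^ 2 * T :=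
      (avg_linear_sq_le _ _).trans
        (mul_le_mul hdiff hT (avg_nonneg fun i => by positivity) (by positivity))
    -- Split `w` into grid point and remainder and use `(P + Q)² ≤ (1 + r) P² + (1 + 1 / r) Q²`. The
    -- remainder is so small that the trace bound suffices for it.
    have h2 : (avg fun i => (∑ j, w j * y i j) ^ 2) ≤
        (1 + r) * (avg fun i => (∑ j, gridPoint K (k j) * y i j) ^ 2) +
        (1 + 1 / r) * avg fun i => (∑ j, (w j - gridPoint K (k j)) * y i j) ^ 2 := by
      rw [← avg_const_mul, ← avg_const_mul, ← avg_add]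
      refine avg_mono fun i => ?_
      set P := ∑ j, gridPoint K (k j) * y i j
      set Q := ∑ j, (w j - gridPoint K (k j)) * y i j with hQ
      have : ∑ j, w j * y i j = P + Q := by
        rw [hQ, ← Finset.sum_add_distrib]
        exact Finset.sum_congr rfl fun j _ => by ring
      rw [this]
      have h3 : 0 ≤ (r * P - Q) ^ 2 / r := by positivity
      have h4 : (r * P - Q) ^ 2 / r = r * P ^ 2 - 2 * P * Q + 1 / r * Q ^ 2 := by
        field_simp; ring
      nlinarith
    refine h2.trans (add_le_add ?_ ?_)
    · exact mul_le_mul_of_nonneg_left (hgrid k hk) (by positivity)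
    · exact mul_le_mul_of_nonneg_left h1 (by positivity)
  have hs : 0 ≤ ∑ j, w j ^ 2 := by positivity
  rcases hs.eq_or_lt with h0 | h0
  · have hw0 : ∀ j, w j = 0 := by
      intro j
      have := (Finset.sum_eq_zero_iff_of_nonneg (fun j _ => sq_nonneg (w j))).mp h0.symm j
        (Finset.mem_univ j)
      simpa using this
    simp [hw0, avg]
  · set l := Real.sqrt (∑ j, w j ^ 2) with hl
    have hlpos : 0 < l := Real.sqrt_pos.mpr h0
    have hl2 : l ^ 2 = ∑ j, w j ^ 2 := Real.sq_sqrt hs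
    have h1 := unit (fun j => w j / l) (by
      simp_rw [div_pow]; rw [← Finset.sum_div, hl2, div_self h0.ne'])
    have h2 : (avg fun i => (∑ j, w j * y i j) ^ 2) =
        (avg fun i => (∑ j, w j / l * y i j) ^ 2) * l ^ 2 := by
      rw [mul_comm, ← avg_const_mul]
      congr 1; ext i
      rw [← mul_pow, Finset.mul_sum]
      congr 1
      exact Finset.sum_congr rfl fun j _ => by field_simp
    rw [h2, ← hl2]
    exact mul_le_mul_of_nonneg_right h1 (sq_nonneg l)

end Grid

/-! ### Angle between the top eigenvector and the separation direction -/

section Angle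

variable {m n : ℕ}

/-- If the variance along the first axis exceeds the variances in its orthogonal complement by
`G`, then the tangent of the angle between the first axis and the top principal direction is
controlled by the covariances. -/
theorem tangent_le_of_gap (hn : n ≠ 0) {p : Fin n → ℝ} {y : Fin n → Fin m → ℝ} {α B G : ℝ}
    {w : Fin m → ℝ} (hG : 0 < G)
    (hA : B + G ≤ avg fun i => (p i - avg p) ^ 2)
    (hB : (avg fun i => (∑ j, w j * (y i j - avg fun i => y i j)) ^ 2) ≤ B * ∑ j, w j ^ 2)
    (hpos : 0 < α ^ 2 + ∑ j, w j ^ 2)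
    (htop : (avg fun i => (p i - avg p) ^ 2) * (α ^ 2 + ∑ j, w j ^ 2) ≤
      avg fun i => (α * (p i - avg p) + ∑ j, w j * (y i j - avg fun i => y i j)) ^ 2) :
    α ≠ 0 ∧ G * Real.sqrt (∑ j, (w j / α) ^ 2) ≤
      2 * Real.sqrt (∑ j, ((avg fun i => p i * y i j) - avg p * avg fun i => y i j) ^ 2) := by
  set A := avg fun i => (p i - avg p) ^ 2 with hAdef
  set g : Fin m → ℝ := fun j => (avg fun i => p i * y i j) - avg p * avg fun i => y i j with hg
  have hexp : (avg fun i => (α * (p i - avg p) + ∑ j, w j * (y i j - avg fun i => y i j)) ^ 2) =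
      α ^ 2 * A + (2 * α * ∑ j, w j * g j +
        avg fun i => (∑ j, w j * (y i j - avg fun i => y i j)) ^ 2) := by
    have h1 : ∑ j, w j * g j =
        avg fun i => (p i - avg p) * ∑ j, w j * (y i j - avg fun i => y i j) := by
      simp only [hg, Finset.mul_sum]
      rw [avg_finsetSum]
      refine Finset.sum_congr rfl fun j _ => ?_
      rw [← avg_centered_mul hn, ← avg_const_mul]
      congr 1; ext i; ring
    rw [h1, ← avg_const_mul, ← avg_const_mul, ← avg_add, ← avg_add]
    congr 1; ext i; ring
  rw [hexp] at htop
  have hW : 0 ≤ ∑ j, w j ^ 2 := by positivity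
  -- In the expanded quadratic form `α² A` cancels from both sides, which leaves `(A - B)|w|²`
  -- against the cross term. For `α = 0` this forces `w = 0`, contradicting `hpos`; otherwise
  -- division by `α²` and Cauchy–Schwarz give the tangent.
  have key : G * ∑ j, w j ^ 2 ≤ 2 * α * ∑ j, w j * g j := by
    have := mul_le_mul_of_nonneg_right hA hW
    linarith
  have hα : α ≠ 0 := by
    rintro rfl
    simp only [mul_zero, zero_mul, ne_eq, OfNat.ofNat_ne_zero, not_false_eq_true, zero_pow,
      zero_add] at key hpos
    nlinarith
  refine ⟨hα, ?_⟩
  have hW2 : ∑ j, (w j / α) ^ 2 = (∑ j, w j ^ 2) / α ^ 2 := by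
    simp_rw [div_pow]; rw [Finset.sum_div]
  have hcs : (∑ j, w j / α * g j) ≤
      Real.sqrt (∑ j, (w j / α) ^ 2) * Real.sqrt (∑ j, g j ^ 2) :=
    Real.sum_mul_le_sqrt_mul_sqrt _ _ _
  set t := Real.sqrt (∑ j, (w j / α) ^ 2) with ht
  have ht0 : 0 ≤ t := Real.sqrt_nonneg _
  have ht2 : t ^ 2 = (∑ j, w j ^ 2) / α ^ 2 := by
    rw [ht, Real.sq_sqrt (by positivity), hW2]
  have hg' : ∑ j, w j / α * g j = (∑ j, w j * g j) / α := by
    rw [Finset.sum_div]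
    exact Finset.sum_congr rfl fun j _ => by ring
  have key2 : G * t ^ 2 ≤ 2 * (t * Real.sqrt (∑ j, g j ^ 2)) := by
    have hα2 : 0 < α ^ 2 := by positivity
    have h1 : G * t ^ 2 ≤ 2 * ∑ j, w j / α * g j := by
      rw [ht2, hg', ← mul_div_assoc, div_le_iff₀ hα2]
      calc _ ≤ _ := key
        _ = _ := by field_simp
    linarith
  rcases ht0.eq_or_lt with h | h
  · rw [← h, mul_zero]; positivity
  · have : t * (G * t) ≤ t * (2 * Real.sqrt (∑ j, g j ^ 2)) := by nlinarith
    exact le_of_mul_le_mul_left this h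

/-- The variance along the separation direction exceeds the noise level by half the squared
separation. -/
theorem variance_separation_ge (hn : n ≠ 0) {γ η : ℝ} (hγ : 0 < γ) (hη : 0 < η)
    (hη1 : η ≤ 1) (hη2 : η ≤ γ ^ 2) {s a : Fin n → ℝ} (hs : ∀ i, s i ^ 2 = 1)
    (h1 : |avg s| ≤ 1 / 4) (h2 : |avg a| ≤ η / 4) (h3 : |avg fun i => s i * a i| ≤ γ / 32)
    (h4 : |avg fun i => a i ^ 2 - 1| ≤ η / 16) :
    1 + η / 16 + γ ^ 2 / 2 ≤
      avg fun i => (γ * s i + a i - avg fun i => γ * s i + a i) ^ 2 := by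
  rw [avg_centered_sq hn (fun i => γ * s i + a i)]
  have e1 : (avg fun i => (γ * s i + a i) ^ 2) =
      γ ^ 2 + 2 * γ * (avg fun i => s i * a i) + (1 + avg fun i => a i ^ 2 - 1) := by
    have : ∀ i, (γ * s i + a i) ^ 2 =
        (γ ^ 2 + 2 * γ * (s i * a i)) + (1 + (a i ^ 2 - 1)) := by
      intro i; nlinarith [hs i]
    simp_rw [this]
    rw [avg_add, avg_add, avg_add, avg_const hn, avg_const hn, avg_const_mul]
  have e2 : (avg fun i => γ * s i + a i) = γ * avg s + avg a := by
    rw [avg_add, avg_const_mul]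
  rw [e1, e2]
  have b1 := sq_le_sq.mpr (h1.trans (le_abs_self _))
  have b2 := sq_le_sq.mpr (h2.trans (le_abs_self _))
  have b3 := (abs_le.mp h3).1
  have b4 := (abs_le.mp h4).1
  have b5 : (γ * avg s + avg a) ^ 2 ≤ 2 * γ ^ 2 * avg s ^ 2 + 2 * avg a ^ 2 := by
    nlinarith [sq_nonneg (γ * avg s - avg a)]
  have b6 : γ ^ 2 * avg s ^ 2 ≤ γ ^ 2 * (1 / 4) ^ 2 :=
    mul_le_mul_of_nonneg_left b1 (sq_nonneg γ)
  have b7 : γ * (-(γ / 32)) ≤ γ * avg fun i => s i * a i := mul_le_mul_of_nonneg_left b3 hγ.le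
  have b8 : (η / 4) ^ 2 ≤ γ ^ 2 / 16 := by nlinarith
  nlinarith

/-- For well separated and roughly balanced clusters the top principal direction is close to the
separation direction. -/
theorem tangent_le_of_separation (hn : n ≠ 0) {γ T : ℝ} {s a : Fin n → ℝ}
    {y : Fin n → Fin m → ℝ} (hs : ∀ i, s i ^ 2 = 1) (hT0 : 0 < T)
    (h1 : |avg s| ≤ 1 / 4) (hT : (avg fun i => a i ^ 2 + ∑ j, y i j ^ 2) ≤ T)
    (hγ : 490 * T ≤ γ ^ 2) {α : ℝ} {w : Fin m → ℝ} (hpos : 0 < α ^ 2 + ∑ j, w j ^ 2)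
    (htop : (avg fun i => (γ * s i + a i - avg fun i => γ * s i + a i) ^ 2) *
        (α ^ 2 + ∑ j, w j ^ 2) ≤
      avg fun i => (α * (γ * s i + a i - avg fun i => γ * s i + a i) +
        ∑ j, w j * (y i j - avg fun i => y i j)) ^ 2) :
    α ≠ 0 ∧ ∑ j, (w j / α) ^ 2 ≤ 1 / 4 := by
  set V := γ ^ 2 * avg fun i => (s i - avg s) ^ 2 with hV
  have hVge : 15 / 16 * γ ^ 2 ≤ V := by
    have b1 := sq_le_sq.mpr (h1.trans (le_abs_self _))
    have : (avg fun i => (s i - avg s) ^ 2) = 1 - avg s ^ 2 := by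
      rw [avg_centered_sq hn]; simp_rw [hs]; rw [avg_const hn]
    rw [hV, this]
    nlinarith [sq_nonneg γ]
  have ecen : ∀ i, (γ * s i + a i - avg fun i => γ * s i + a i) =
      γ * (s i - avg s) + (a i - avg a) := by
    intro i; rw [avg_add, avg_const_mul]; ring
  have hTc : (avg fun i => (a i - avg a) ^ 2 + ∑ j, (y i j - avg fun i => y i j) ^ 2) ≤ T := by
    refine le_trans ?_ hT
    rw [avg_add, avg_add, avg_finsetSum (fun j i => (y i j - avg fun i => y i j) ^ 2),
      avg_finsetSum (fun j i => y i j ^ 2)]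
    exact add_le_add (avg_centered_sq_le hn a)
      (Finset.sum_le_sum fun j _ => avg_centered_sq_le hn fun i => y i j)
  have hac : (avg fun i => (a i - avg a) ^ 2) ≤ T := by
    refine le_trans (avg_mono fun i => ?_) hTc
    have : 0 ≤ ∑ j, (y i j - avg fun i => y i j) ^ 2 := by positivity
    linarith
  set N := α ^ 2 + ∑ j, w j ^ 2 with hN
  -- Pointwise `(x + z)² ≥ 14 x² / 15 - 14 z²`, with `x` the label signal and `z` the noise; `hupp`
  -- uses the companion `(x + z)² ≤ 16 x² / 15 + 16 z²`. No spectral gap of the noise is involved,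
  -- only its trace.
  have hlow : 14 / 15 * V - 14 * T ≤
      avg fun i => (γ * s i + a i - avg fun i => γ * s i + a i) ^ 2 := by
    have : (avg fun i => 14 / 15 * (γ ^ 2 * (s i - avg s) ^ 2) - 14 * (a i - avg a) ^ 2) ≤
        avg fun i => (γ * s i + a i - avg fun i => γ * s i + a i) ^ 2 := by
      refine avg_mono fun i => ?_
      rw [ecen]
      nlinarith [sq_nonneg (γ * (s i - avg s) + 15 * (a i - avg a))]
    rw [avg_sub, avg_const_mul, avg_const_mul, avg_const_mul] at this
    linarith
  have hupp : (avg fun i => (α * (γ * s i + a i - avg fun i => γ * s i + a i) +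
        ∑ j, w j * (y i j - avg fun i => y i j)) ^ 2) ≤ 16 / 15 * (α ^ 2 * V) + 16 * (N * T) := by
    have h3 : (avg fun i => (α * (γ * s i + a i - avg fun i => γ * s i + a i) +
        ∑ j, w j * (y i j - avg fun i => y i j)) ^ 2) ≤
        avg fun i => 16 / 15 * (α ^ 2 * (γ ^ 2 * (s i - avg s) ^ 2)) +
          16 * (N * ((a i - avg a) ^ 2 + ∑ j, (y i j - avg fun i => y i j) ^ 2)) := by
      refine avg_mono fun i => ?_
      rw [ecen]
      set R := α * (a i - avg a) + ∑ j, w j * (y i j - avg fun i => y i j) with hR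
      have h4 : R ^ 2 ≤ N * ((a i - avg a) ^ 2 + ∑ j, (y i j - avg fun i => y i j) ^ 2) := by
        have h5 := Finset.sum_mul_sq_le_sq_mul_sq Finset.univ w
          (fun j => y i j - avg fun i => y i j)
        set C := ∑ j, w j * (y i j - avg fun i => y i j)
        set D := ∑ j, (y i j - avg fun i => y i j) ^ 2
        set W := ∑ j, w j ^ 2
        have hD : 0 ≤ D := by positivity
        have hW : 0 ≤ W := by positivity
        have h6 : (α * (a i - avg a) + C) ^ 2 ≤
            α ^ 2 * (a i - avg a) ^ 2 + 2 * (α * (a i - avg a) * C) + W * D := by nlinarith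
        have h7 : 2 * (α * (a i - avg a) * C) ≤ α ^ 2 * D + W * (a i - avg a) ^ 2 := by
          have h8 : |α * (a i - avg a) * C| ≤
              Real.sqrt (α ^ 2 * D) * Real.sqrt (W * (a i - avg a) ^ 2) := by
            rw [← Real.sqrt_mul (by positivity)]
            refine Real.le_sqrt_of_sq_le ?_
            rw [sq_abs]
            have := mul_le_mul_of_nonneg_left h5
              (by positivity : 0 ≤ α ^ 2 * (a i - avg a) ^ 2)
            nlinarith
          have h9 := le_abs_self (α * (a i - avg a) * C)
          have h10 := Real.sq_sqrt (by positivity : 0 ≤ α ^ 2 * D)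
          have h11 := Real.sq_sqrt (by positivity : 0 ≤ W * (a i - avg a) ^ 2)
          nlinarith [sq_nonneg (Real.sqrt (α ^ 2 * D) - Real.sqrt (W * (a i - avg a) ^ 2))]
        rw [hN]
        nlinarith
      have h5 : α * (γ * (s i - avg s) + (a i - avg a)) +
          ∑ j, w j * (y i j - avg fun i => y i j) = α * (γ * (s i - avg s)) + R := by
        rw [hR]; ring
      rw [h5]
      nlinarith [sq_nonneg (α * (γ * (s i - avg s)) - 15 * R)]
    refine h3.trans ?_
    rw [avg_add, avg_const_mul, avg_const_mul, avg_const_mul, avg_const_mul, avg_const_mul]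
    have := mul_le_mul_of_nonneg_left hTc hpos.le
    linarith
  have key : (14 / 15 * V - 14 * T) * N ≤ 16 / 15 * (α ^ 2 * V) + 16 * (N * T) :=
    (mul_le_mul_of_nonneg_right hlow hpos.le).trans (htop.trans hupp)
  -- `459 < 490 * 15 / 16`.
  have hVT : 459 * T ≤ V := by nlinarith
  have hV0 : 0 < V := by linarith
  -- The factor `4 / 5` is exactly what `|w|² ≤ α² / 4` requires. It follows from `14 / 15 - 30 /
  -- 459 ≥ (16 / 15) * (4 / 5)`.
  have key2 : 4 / 5 * N ≤ α ^ 2 := by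
    have h3 : 459 * T * N ≤ V * N := mul_le_mul_of_nonneg_right hVT hpos.le
    have h4 : V * (4 / 5 * N) ≤ V * α ^ 2 := by nlinarith
    exact le_of_mul_le_mul_left h4 hV0
  have hα2 : 0 < α ^ 2 := by linarith
  refine ⟨fun h => by simp [h] at hα2, ?_⟩
  simp_rw [div_pow]
  rw [← Finset.sum_div, div_le_iff₀ hα2]
  linarith

end Angle

/-! ### The exponential bound -/

section Fast

variable {m n : ℕ}

theorem latentMeasure_abs_le_exp {γ τ : ℝ} (hγ : 0 < γ) {β : Fin m → ℝ}
    (hβ : ∑ j, β j ^ 2 ≤ 1 / 4) (hτ : |τ| ≤ 2 / 5 * γ) :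
    latentMeasure m {ω | |γ * labelSign ω.1 + ω.2.1| ≤ |∑ j, β j * ω.2.2 j - τ|} ≤
      ENNReal.ofReal (4 * Real.exp (-(γ ^ 2 / 20))) := by
  set Z1 : Set (ℝ × (Fin m → ℝ)) := {z | 2 / 5 * γ ≤ |1 * z.1 + ∑ j, (0 : Fin m → ℝ) j * z.2 j|}
  set Z2 : Set (ℝ × (Fin m → ℝ)) := {z | 2 / 5 * γ ≤ |0 * z.1 + ∑ j, (2 * β j) * z.2 j|}
  have hsub : {ω : Latent m | |γ * labelSign ω.1 + ω.2.1| ≤ |∑ j, β j * ω.2.2 j - τ|} ⊆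
      Prod.snd ⁻¹' (Z1 ∪ Z2) := by
    intro ω hω
    -- Outside `Z1` and `Z2` one has `|a| < 2γ / 5` and `|β · y| < γ / 5`, so `γ ≤ |a| + |β · y| +
    -- |τ| < γ`. The factor `2` in `Z2` uses that `2β` still lies in the unit ball.
    by_contra hcon
    simp only [Z1, Z2, Set.mem_preimage, Set.mem_union, Set.mem_ofPred_eq, not_or, not_le,
      one_mul, Pi.zero_apply, zero_mul, Finset.sum_const_zero, add_zero, zero_add, mul_assoc,
      ← Finset.mul_sum, abs_mul, abs_two] at hcon hω
    have h3 : |γ * labelSign ω.1| = γ := by rw [abs_mul, abs_labelSign, mul_one, abs_of_pos hγ]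
    have h4 : |γ * labelSign ω.1| ≤ |γ * labelSign ω.1 + ω.2.1| + |ω.2.1| := by
      have := abs_sub (γ * labelSign ω.1 + ω.2.1) ω.2.1
      rwa [add_sub_cancel_right] at this
    have h5 := abs_sub (∑ j, β j * ω.2.2 j) τ
    linarith [hcon.1, hcon.2]
  have hmeas : MeasurableSet (Z1 ∪ Z2) :=
    (measurableSet_le (by fun_prop) (by fun_prop)).union
      (measurableSet_le (by fun_prop) (by fun_prop))
  have hmp : MeasurePreserving Prod.snd (latentMeasure m) (noiseMeasure m) :=
    measurePreserving_snd (μ := labelMeasure) (ν := noiseMeasure m)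
  refine (measure_mono hsub).trans ?_
  rw [hmp.measure_preimage hmeas.nullMeasurableSet]
  have b1 := noiseMeasure_linear_ge_le (m := m) (α := 1) (w := 0) (by simp)
    (h := 2 / 5 * γ) (by positivity)
  have b2 := noiseMeasure_linear_ge_le (m := m) (α := 0) (w := fun j => 2 * β j) (by
    simp_rw [mul_pow]; rw [← Finset.mul_sum]; linarith) (h := 2 / 5 * γ) (by positivity)
  refine (measure_union_le _ _).trans ((add_le_add b1 b2).trans ?_)
  rw [← ENNReal.ofReal_add (by positivity) (by positivity)]
  refine ENNReal.ofReal_le_ofReal ?_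
  have : Real.exp (-(3 / 8 * (2 / 5 * γ) ^ 2)) ≤ Real.exp (-(γ ^ 2 / 20)) :=
    Real.exp_le_exp.mpr (by nlinarith [sq_nonneg γ])
  linarith

theorem abs_threshold_le (hn : n ≠ 0) {γ T : ℝ} (hγ0 : 0 < γ) {s a : Fin n → ℝ}
    {y : Fin n → Fin m → ℝ} {β : Fin m → ℝ} (h1 : |avg s| ≤ 1 / 4)
    (hT : (avg fun i => a i ^ 2 + ∑ j, y i j ^ 2) ≤ T)
    (hγ : 490 * T ≤ γ ^ 2) (hβ : ∑ j, β j ^ 2 ≤ 1 / 4) :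
    |(avg fun i => γ * s i + a i) + ∑ j, β j * avg fun i => y i j| ≤ 2 / 5 * γ := by
  rw [avg_add, avg_const_mul, avg_finsetSum (fun j i => y i j ^ 2)] at *
  set D := ∑ j, (avg fun i => y i j) ^ 2 with hD
  set C := ∑ j, β j * avg fun i => y i j
  have hD0 : 0 ≤ D := by positivity
  have h2 := Finset.sum_mul_sq_le_sq_mul_sq Finset.univ β (fun j => avg fun i => y i j)
  have h3 : D ≤ ∑ j, avg fun i => y i j ^ 2 :=
    Finset.sum_le_sum fun j _ => sq_avg_le hn fun i => y i j
  have h4 := sq_avg_le hn a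
  have h5 : C ^ 2 ≤ 1 / 4 * D := h2.trans (mul_le_mul_of_nonneg_right hβ hD0)
  -- The squared left side is at most `2T ≤ 2γ² / 490`; together with `γ / 4` from the label
  -- imbalance the total is `2γ / 5`.
  have h6 : |avg a + C| ≤ 3 / 20 * γ := by
    refine abs_le_of_sq_le_sq ?_ (by positivity)
    nlinarith [sq_nonneg (avg a - C)]
  have h7 : |γ * avg s| ≤ γ * (1 / 4) := by
    rw [abs_mul, abs_of_pos hγ0]; exact mul_le_mul_of_nonneg_left h1 hγ0.le
  calc _ = |γ * avg s + (avg a + C)| := by ring_nf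
    _ ≤ _ := abs_add_le _ _
    _ ≤ _ := by linarith

variable (b : OrthonormalBasis (Fin (m + 1)) ℝ (EuclideanSpace ℝ (Fin (m + 1))))

/-- The loss is at most `1` when the labels are unbalanced or the trace is large, which costs `2 +
1` exponentials in `n`; on all other samples the bound in `γ` is deterministic. -/
theorem expectedLoss_le_exp (hn : n ≠ 0) (c : EuclideanSpace ℝ (Fin (m + 1))) {σ γ : ℝ}
    (hσ : 0 < σ) (hγ0 : 0 < γ) (hγ : 490 * (2 * (m + 1 : ℝ)) ≤ γ ^ 2)
    (v : (Fin n → EuclideanSpace ℝ (Fin (m + 1))) → EuclideanSpace ℝ (Fin (m + 1)))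
    (hv : ∀ X, IsTopEigenvector (sampleCovariance X) (v X)) :
    expectedLoss σ v (c + (σ * γ) • b 0, c - (σ * γ) • b 0) ≤
      ENNReal.ofReal (3 * Real.exp (-(n : ℝ) / 32) + 4 * Real.exp (-(γ ^ 2 / 20))) := by
  set B1 : Set (Fin n → Latent m) := {ω | 1 / 4 ≤ |avg fun i => labelSign (ω i).1|} with hB1
  set B2 : Set (Fin n → Latent m) :=
    {ω | 2 * (m + 1 : ℝ) ≤ avg fun i => (ω i).2.1 ^ 2 + ∑ j, (ω i).2.2 j ^ 2} with hB2
  have hm1 : MeasurableSet B1 := measurableSet_le measurable_const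
    (measurable_avg (f := fun ω : Latent m => labelSign ω.1)
      (measurable_labelSign.comp measurable_fst)).abs
  have hm2 : MeasurableSet B2 := measurableSet_le measurable_const
    (measurable_avg (f := fun ω : Latent m => ω.2.1 ^ 2 + ∑ j, ω.2.2 j ^ 2) (by fun_prop))
  have hmB := hm1.union hm2
  refine (expectedLoss_le_lintegral b c hσ γ v rfl (g := fun ω =>
    (B1 ∪ B2).indicator 1 ω + ENNReal.ofReal (4 * Real.exp (-(γ ^ 2 / 20))))
    ((measurable_one.indicator hmB).add measurable_const) fun ω => ?_).trans ?_
  · by_cases hω : ω ∈ B1 ∪ B2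
    · refine (clusteringLoss_le_one b c hσ γ _).trans ?_
      simp [hω]
    · rw [Set.indicator_of_notMem hω, zero_add]
      simp only [hB1, hB2, Set.mem_union, Set.mem_ofPred_eq, not_or, not_le] at hω
      obtain ⟨α, w, hvw, hpos, htop⟩ := (hv fun i => embed b c σ γ (ω i)).exists_frame b hn c hσ γ ω
      obtain ⟨hα, hβ⟩ := tangent_le_of_separation hn (s := fun i => labelSign (ω i).1)
        (a := fun i => (ω i).2.1) (y := fun i => (ω i).2.2)
        (fun i => labelSign_sq _) (by positivity) hω.1.le hω.2.le hγ hpos htop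
      have hτ := abs_threshold_le hn hγ0 (β := fun j => w j / α) hω.1.le hω.2.le hγ hβ
      rw [hvw, sampleMean_embed b hn]
      exact (clusteringLoss_le b c hσ hγ0 hα _ w _).trans (latentMeasure_abs_le_exp hγ0 hβ hτ)
  · change ∫⁻ ω, _ ∂(latentSample m n) ≤ _
    rw [lintegral_add_right _ measurable_const, lintegral_indicator_one hmB, lintegral_const,
      measure_univ, mul_one]
    refine (add_le_add_left ((measure_union_le _ _).trans (add_le_add
      (latentSample_avg_sign_ge_le hn) (latentSample_trace_ge_le hn))) _).trans_eq ?_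
    rw [← ENNReal.ofReal_add (by positivity) (by positivity),
      ← ENNReal.ofReal_add (by positivity) (by positivity)]
    congr 1; ring

end Fast

/-! ### Control of the loss by sample statistics -/

section Slow

variable {m n : ℕ}

/-- The samples whose noise has a large covariance in some direction of the grid. -/
def largeNoise (m n K : ℕ) (ε : ℝ) : Set (Fin n → Latent m) :=
  {ω | 2 * (m + 1 : ℝ) ≤ avg fun i => (ω i).2.1 ^ 2 + ∑ j, (ω i).2.2 j ^ 2} ∪
    ⋃ k : Fin m → Fin (2 * K + 1), {ω | ∑ j, gridPoint K (k j) ^ 2 ≤ 1 ∧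
      1 + ε ≤ avg fun i => (∑ j, gridPoint K (k j) * (ω i).2.2 j) ^ 2}

theorem measurableSet_largeNoise (m n K : ℕ) (ε : ℝ) : MeasurableSet (largeNoise m n K ε) := by
  refine MeasurableSet.union ?_ (MeasurableSet.iUnion fun k => MeasurableSet.inter
    (MeasurableSet.const _) ?_)
  · exact measurableSet_le measurable_const
      (measurable_avg (f := fun ω : Latent m => ω.2.1 ^ 2 + ∑ j, ω.2.2 j ^ 2) (by fun_prop))
  · exact measurableSet_le measurable_const
      (measurable_avg (f := fun ω : Latent m => (∑ j, gridPoint K (k j) * ω.2.2 j) ^ 2)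
        (by fun_prop))

theorem latentSample_largeNoise_le (hn : n ≠ 0) (K : ℕ) {ε : ℝ} (hε0 : 0 < ε) (hε : ε ≤ 1) :
    latentSample m n (largeNoise m n K ε) ≤
      ENNReal.ofReal (Real.exp (-(n : ℝ) / 32) +
        (2 * K + 1) ^ m * Real.exp (-(n * ε ^ 2 / 8))) := by
  rw [ENNReal.ofReal_add (by positivity) (by positivity)]
  refine (measure_union_le _ _).trans (add_le_add (latentSample_trace_ge_le hn) ?_)
  refine (measure_iUnion_fintype_le _ _).trans ?_
  calc _ ≤ ∑ _k : Fin m → Fin (2 * K + 1), ENNReal.ofReal (Real.exp (-(n * ε ^ 2 / 8))) := by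
        refine Finset.sum_le_sum fun k _ => ?_
        by_cases hk : ∑ j, gridPoint K (k j) ^ 2 ≤ 1
        · refine (measure_mono fun ω hω => ?_).trans (latentSample_linear_sq_ge_le hn hk hε0 hε)
          exact hω.2
        · simp [hk]
    _ = _ := by
        rw [Finset.sum_const, Finset.card_univ, Fintype.card_fun, Fintype.card_fin,
          Fintype.card_fin, ENNReal.ofReal_mul (by positivity), nsmul_eq_mul]
        congr 1
        rw [show ((2 * (K : ℝ) + 1) ^ m) = (((2 * K + 1) ^ m : ℕ) : ℝ) by push_cast; rfl,
          ENNReal.ofReal_natCast]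

theorem noise_quadratic_le {K : ℕ} (hK : 0 < K) {ε : ℝ} (hε : 0 < ε) {ω : Fin n → Latent m}
    (hω : ω ∉ largeNoise m n K ε) (w : Fin m → ℝ) :
    (avg fun i => (∑ j, w j * (ω i).2.2 j) ^ 2) ≤
      ((1 + ε) * (1 + ε) + (1 + 1 / ε) * (m / K ^ 2 * (2 * (m + 1 : ℝ)))) * ∑ j, w j ^ 2 := by
  simp only [largeNoise, Set.mem_union, Set.mem_iUnion, Set.mem_ofPred_eq, not_or, not_exists,
    not_and, not_le] at hω
  refine quadratic_le_of_grid hK hε ?_ (fun k hk => (hω.2 k hk).le) w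
  refine le_trans (avg_mono fun i => ?_) hω.1.le
  linarith [sq_nonneg (ω i).2.1]

/-- The combination of sample statistics that controls the loss. -/
def lossStat (ω : Fin n → Latent m) : ℝ :=
  16 * Real.sqrt (∑ j, (avg fun i => labelSign (ω i).1 * (ω i).2.2 j) ^ 2) +
  (33 * Real.sqrt (∑ j, (avg fun i => (ω i).2.2 j) ^ 2) +
  (16 * Real.sqrt (∑ j, (avg fun i => (ω i).2.1 * (ω i).2.2 j) ^ 2) +
  (6 * |avg fun i => labelSign (ω i).1| + (6 * |avg fun i => (ω i).2.1| +
  (32 * |avg fun i => labelSign (ω i).1 * (ω i).2.1| +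
  16 * |avg fun i => (ω i).2.1 ^ 2 - 1|)))))

theorem sqrt_sum_add_sq_le (x y : Fin m → ℝ) :
    Real.sqrt (∑ j, (x j + y j) ^ 2) ≤ Real.sqrt (∑ j, x j ^ 2) + Real.sqrt (∑ j, y j ^ 2) := by
  have := norm_add_le (WithLp.toLp 2 x : EuclideanSpace ℝ (Fin m)) (WithLp.toLp 2 y)
  simpa [EuclideanSpace.norm_eq] using this

theorem sqrt_sum_mul_sq (c : ℝ) (x : Fin m → ℝ) :
    Real.sqrt (∑ j, (c * x j) ^ 2) = |c| * Real.sqrt (∑ j, x j ^ 2) := by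
  simp_rw [mul_pow]
  rw [← Finset.mul_sum, Real.sqrt_mul (sq_nonneg c), Real.sqrt_sq_eq_abs]

variable (b : OrthonormalBasis (Fin (m + 1)) ℝ (EuclideanSpace ℝ (Fin (m + 1))))

/-- The cross-covariance splits into a label part, multiplied by `γ`, and a pure noise part. The
centring terms are absorbed by bounding `|avg s|` and `|avg a|` by `1`. -/
theorem sqrt_cross_covariance_le {γ : ℝ} (hγ : 0 < γ) {s a : Fin n → ℝ}
    {y : Fin n → Fin m → ℝ} (hs : |avg s| ≤ 1) (ha : |avg a| ≤ 1) :
    Real.sqrt (∑ j, ((avg fun i => (γ * s i + a i) * y i j) -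
      (avg fun i => γ * s i + a i) * avg fun i => y i j) ^ 2) ≤
    γ * (Real.sqrt (∑ j, (avg fun i => s i * y i j) ^ 2) +
        Real.sqrt (∑ j, (avg fun i => y i j) ^ 2)) +
      (Real.sqrt (∑ j, (avg fun i => a i * y i j) ^ 2) +
        Real.sqrt (∑ j, (avg fun i => y i j) ^ 2)) := by
  have e : ∀ j, ((avg fun i => (γ * s i + a i) * y i j) -
      (avg fun i => γ * s i + a i) * avg fun i => y i j) =
      (γ * ((avg fun i => s i * y i j) + (-avg s) * avg fun i => y i j)) +
        ((avg fun i => a i * y i j) + (-avg a) * avg fun i => y i j) := by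
    intro j
    rw [avg_add, avg_const_mul]
    have : (avg fun i => (γ * s i + a i) * y i j) =
        γ * (avg fun i => s i * y i j) + avg fun i => a i * y i j := by
      rw [← avg_const_mul, ← avg_add]; congr 1; ext i; ring
    rw [this]; ring
  simp_rw [e]
  have hN : 0 ≤ Real.sqrt (∑ j, (avg fun i => y i j) ^ 2) := Real.sqrt_nonneg _
  refine (sqrt_sum_add_sq_le _ _).trans (add_le_add ?_ ?_)
  · rw [sqrt_sum_mul_sq, abs_of_pos hγ]
    refine mul_le_mul_of_nonneg_left ((sqrt_sum_add_sq_le _ _).trans ?_) hγ.le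
    rw [sqrt_sum_mul_sq, abs_neg]
    nlinarith
  · refine (sqrt_sum_add_sq_le _ _).trans ?_
    rw [sqrt_sum_mul_sq, abs_neg]
    nlinarith

/-- With `q = max 1 γ`, the tangent satisfies `β ≤ 4 M q (N₁ + 2 N₀ + N₂)` because `1 ≤ M γ²`. The
small-interval factor `2 / q` cancels `q`, so the bound is uniform for large `γ`. Since `N₀ ≤ 1`,
the threshold contributes at most one further `β`. -/
theorem loss_arith {γ M β g N₀ N₁ N₂ S A τ : ℝ} (hγ : 0 < γ) (hM : M = max (1 / γ ^ 2) 1)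
    (hN₀ : 0 ≤ N₀) (hN₁ : 0 ≤ N₁) (hN₂ : 0 ≤ N₂) (hS : 0 ≤ S) (hA : 0 ≤ A) (hN₀1 : N₀ ≤ 1)
    (hβ0 : 0 ≤ β) (hβ : γ ^ 2 / 2 * β ≤ 2 * g) (hg : g ≤ γ * (N₁ + N₀) + (N₂ + N₀))
    (hτ : τ ≤ γ * S + A + β * N₀) :
    2 / max 1 γ * (β + τ) ≤ M * (16 * N₁ + 32 * N₀ + 16 * N₂ + 2 * S + 2 * A) := by
  have hM1 : 1 ≤ M := hM ▸ le_max_right _ _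
  have hM2 : 1 / γ ^ 2 ≤ M := hM ▸ le_max_left _ _
  set q := max 1 γ with hq
  have hq1 : 1 ≤ q := le_max_left _ _
  have hq2 : γ ≤ q := le_max_right _ _
  have hq0 : 0 < q := by linarith
  have hγ2 : 1 ≤ M * γ ^ 2 := by rwa [div_le_iff₀ (by positivity)] at hM2
  have hβN : β * N₀ ≤ β := by nlinarith
  have hβ2 : β ≤ M * (4 * (q * (N₁ + 2 * N₀ + N₂))) := by
    have h1 : g ≤ q * (N₁ + 2 * N₀ + N₂) := by nlinarith
    have h2 : β ≤ M * γ ^ 2 * β := by nlinarith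
    have h3 : M * (γ ^ 2 * β) ≤ M * (4 * (q * (N₁ + 2 * N₀ + N₂))) :=
      mul_le_mul_of_nonneg_left (by linarith) (by linarith)
    linarith
  have hτ2 : γ * S + A ≤ M * (q * (S + A)) := by
    have h1 : γ * S + A ≤ q * (S + A) := by nlinarith
    have h2 : q * (S + A) ≤ M * (q * (S + A)) :=
      le_mul_of_one_le_left (by positivity) hM1
    linarith
  rw [div_mul_eq_mul_div, div_le_iff₀ hq0]
  nlinarith

theorem clusteringLoss_le_lossStat (hn : n ≠ 0) (c : EuclideanSpace ℝ (Fin (m + 1))) {σ γ M : ℝ}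
    (hσ : 0 < σ) (hγ : 0 < γ) (hM : M = max (1 / γ ^ 2) 1) {K : ℕ} (hK : 0 < K) {ε : ℝ}
    (hε : 0 < ε)
    (hεM : (1 + ε) * (1 + ε) + (1 + 1 / ε) * (m / K ^ 2 * (2 * (m + 1 : ℝ))) ≤ 1 + M⁻¹ / 16)
    {v : (Fin n → EuclideanSpace ℝ (Fin (m + 1))) → EuclideanSpace ℝ (Fin (m + 1))}
    (hv : ∀ X, IsTopEigenvector (sampleCovariance X) (v X)) {ω : Fin n → Latent m}
    (hω : ω ∉ largeNoise m n K ε) :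
    clusteringLoss σ (c + (σ * γ) • b 0, c - (σ * γ) • b 0)
      (linearAssignment (v fun i => embed b c σ γ (ω i))
        (sampleMean fun i => embed b c σ γ (ω i))) ≤ ENNReal.ofReal (M * lossStat ω) := by
  have hM1 : 1 ≤ M := hM ▸ le_max_right _ _
  have hM2 : 1 / γ ^ 2 ≤ M := hM ▸ le_max_left _ _
  have hM0 : 0 < M := by linarith
  have hη1 : M⁻¹ ≤ 1 := inv_le_one_of_one_le₀ hM1
  have hη2 : M⁻¹ ≤ γ ^ 2 := by
    rw [inv_le_comm₀ hM0 (by positivity), ← one_div]; exact hM2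
  have hMγ : 1 ≤ M * γ := by
    have h1 : 1 ≤ M * γ ^ 2 := by rwa [div_le_iff₀ (by positivity)] at hM2
    have h2 : 1 ≤ (M * γ) ^ 2 := by nlinarith
    exact (one_le_sq_iff₀ (by positivity)).mp h2
  obtain ⟨α, w, hvw, hpos, htop⟩ := (hv fun i => embed b c σ γ (ω i)).exists_frame b hn c hσ γ ω
  set N₁ := Real.sqrt (∑ j, (avg fun i => labelSign (ω i).1 * (ω i).2.2 j) ^ 2) with hN₁
  set N₀ := Real.sqrt (∑ j, (avg fun i => (ω i).2.2 j) ^ 2) with hN₀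
  set N₂ := Real.sqrt (∑ j, (avg fun i => (ω i).2.1 * (ω i).2.2 j) ^ 2) with hN₂
  set S := |avg fun i => labelSign (ω i).1| with hS
  set A := |avg fun i => (ω i).2.1| with hA
  set SA := |avg fun i => labelSign (ω i).1 * (ω i).2.1| with hSA
  set Q := |avg fun i => (ω i).2.1 ^ 2 - 1| with hQ
  have hN₁0 : 0 ≤ N₁ := Real.sqrt_nonneg _
  have hN₀0 : 0 ≤ N₀ := Real.sqrt_nonneg _
  have hN₂0 : 0 ≤ N₂ := Real.sqrt_nonneg _
  have hS0 : 0 ≤ S := abs_nonneg _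
  have hA0 : 0 ≤ A := abs_nonneg _
  have hSA0 : 0 ≤ SA := abs_nonneg _
  have hQ0 : 0 ≤ Q := abs_nonneg _
  have hstat : lossStat ω = 16 * N₁ + (33 * N₀ + (16 * N₂ + (6 * S + (6 * A + (32 * SA +
    16 * Q))))) := rfl
  -- These are the conditions for the variance gap with `η = M⁻¹`, plus `N₀ ≤ 1`. If one fails, its
  -- own term in `lossStat` already makes `M * lossStat` at least `1`, and the trivial bound on the
  -- loss applies; for `SA` this uses `1 ≤ M * γ`.
  by_cases hgood : S ≤ 1 / 4 ∧ A ≤ M⁻¹ / 4 ∧ SA ≤ γ / 32 ∧ Q ≤ M⁻¹ / 16 ∧ N₀ ≤ 1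
  · obtain ⟨g1, g2, g3, g4, g5⟩ := hgood
    have hvar := variance_separation_ge hn hγ (inv_pos.mpr hM0) hη1 hη2
      (fun i => labelSign_sq (ω i).1) g1 g2 g3 g4
    have hB : (avg fun i => (∑ j, w j * ((ω i).2.2 j - avg fun i => (ω i).2.2 j)) ^ 2) ≤
        (1 + M⁻¹ / 16) * ∑ j, w j ^ 2 := by
      have h1 : (avg fun i => (∑ j, w j * ((ω i).2.2 j - avg fun i => (ω i).2.2 j)) ^ 2) ≤
          avg fun i => (∑ j, w j * (ω i).2.2 j) ^ 2 := by
        refine le_trans (le_of_eq ?_) (avg_centered_sq_le hn fun i => ∑ j, w j * (ω i).2.2 j)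
        congr 1; ext i
        rw [avg_finsetSum (fun j i => w j * (ω i).2.2 j)]
        simp_rw [avg_const_mul, mul_sub, Finset.sum_sub_distrib]
      exact h1.trans ((noise_quadratic_le hK hε hω w).trans
        (mul_le_mul_of_nonneg_right hεM (by positivity)))
    obtain ⟨hα, hβ⟩ := tangent_le_of_gap hn (p := fun i => γ * labelSign (ω i).1 + (ω i).2.1)
      (y := fun i => (ω i).2.2) (B := 1 + M⁻¹ / 16) (G := γ ^ 2 / 2) (by positivity)
      hvar hB hpos htop
    rw [hvw, sampleMean_embed b hn]
    refine (clusteringLoss_le b c hσ hγ hα _ w _).trans ((latentMeasure_abs_le hγ _ _).trans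
      (ENNReal.ofReal_le_ofReal ?_))
    have hcov := sqrt_cross_covariance_le hγ (s := fun i => labelSign (ω i).1)
      (a := fun i => (ω i).2.1) (y := fun i => (ω i).2.2) (by linarith) (by linarith)
    have hτ : |(avg fun i => γ * labelSign (ω i).1 + (ω i).2.1) +
        ∑ j, w j / α * avg fun i => (ω i).2.2 j| ≤
        γ * S + A + Real.sqrt (∑ j, (w j / α) ^ 2) * N₀ := by
      rw [avg_add, avg_const_mul]
      refine (abs_add_three _ _ _).trans (add_le_add_three ?_ le_rfl ?_)
      · rw [abs_mul, abs_of_pos hγ]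
      · rw [← Real.sqrt_sq_eq_abs, hN₀, ← Real.sqrt_mul (by positivity)]
        exact Real.sqrt_le_sqrt (Finset.sum_mul_sq_le_sq_mul_sq _ _ _)
    refine (loss_arith hγ hM hN₀0 hN₁0 hN₂0 hS0 hA0 g5 (Real.sqrt_nonneg _) hβ hcov hτ).trans ?_
    rw [hstat]
    refine mul_le_mul_of_nonneg_left ?_ hM0.le
    linarith
  · refine (clusteringLoss_le_one b c hσ γ _).trans ?_
    rw [ENNReal.one_le_ofReal, hstat]
    have hMinv : M * M⁻¹ = 1 := mul_inv_cancel₀ hM0.ne'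
    have hge : ∀ r : ℝ, 0 ≤ r → r ≤ M * r := fun r hr => le_mul_of_one_le_left hr hM1
    have p1 := mul_nonneg hM0.le hN₁0
    have p2 := mul_nonneg hM0.le hN₀0
    have p3 := mul_nonneg hM0.le hN₂0
    have p4 := mul_nonneg hM0.le hS0
    have p5 := mul_nonneg hM0.le hA0
    have p6 := mul_nonneg hM0.le hSA0
    have p7 := mul_nonneg hM0.le hQ0
    have hexp : M * (16 * N₁ + (33 * N₀ + (16 * N₂ + (6 * S + (6 * A + (32 * SA + 16 * Q)))))) =
        16 * (M * N₁) + 33 * (M * N₀) + 16 * (M * N₂) + 6 * (M * S) + 6 * (M * A) +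
          32 * (M * SA) + 16 * (M * Q) := by ring
    by_contra hlt
    rw [not_le, hexp] at hlt
    have q1 := hge S hS0
    have q2 := hge N₀ hN₀0
    refine hgood ⟨by linarith, le_of_mul_le_mul_left ?_ hM0, le_of_mul_le_mul_left ?_ hM0,
      le_of_mul_le_mul_left ?_ hM0, by linarith⟩
    · rw [← mul_div_assoc, hMinv]; linarith
    · rw [← mul_div_assoc]; linarith
    · rw [← mul_div_assoc, hMinv]; linarith

end Slow

/-! ### Integration and choice of constants for the root-n bound -/

section Rate

variable {m n : ℕ}

theorem lintegral_ofReal_add_le {Ω : Type*} [MeasurableSpace Ω] {μ : Measure Ω} {f g : Ω → ℝ}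
    (hf : Measurable f) (hf0 : ∀ x, 0 ≤ f x) (hg0 : ∀ x, 0 ≤ g x) {a b : ℝ} (ha : 0 ≤ a)
    (hb : 0 ≤ b) (hfa : ∫⁻ x, ENNReal.ofReal (f x) ∂μ ≤ ENNReal.ofReal a)
    (hgb : ∫⁻ x, ENNReal.ofReal (g x) ∂μ ≤ ENNReal.ofReal b) :
    ∫⁻ x, ENNReal.ofReal (f x + g x) ∂μ ≤ ENNReal.ofReal (a + b) := by
  simp_rw [ENNReal.ofReal_add (hf0 _) (hg0 _)]
  rw [lintegral_add_left hf.ennreal_ofReal, ENNReal.ofReal_add ha hb]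
  exact add_le_add hfa hgb

theorem lintegral_ofReal_const_mul_le {Ω : Type*} [MeasurableSpace Ω] {μ : Measure Ω} {f : Ω → ℝ}
    {c a : ℝ} (hc : 0 ≤ c) (hfa : ∫⁻ x, ENNReal.ofReal (f x) ∂μ ≤ ENNReal.ofReal a) :
    ∫⁻ x, ENNReal.ofReal (c * f x) ∂μ ≤ ENNReal.ofReal (c * a) := by
  simp_rw [ENNReal.ofReal_mul hc]
  rw [lintegral_const_mul' _ _ ENNReal.ofReal_ne_top]
  gcongr

theorem measurable_avg_sign_mul {f : ℝ × (Fin m → ℝ) → ℝ} (hf : Measurable f) :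
    Measurable fun ω : Fin n → Latent m => avg fun i => labelSign (ω i).1 * f (ω i).2 :=
  measurable_avg (f := fun ω : Latent m => labelSign ω.1 * f ω.2)
    ((measurable_labelSign.comp measurable_fst).mul (hf.comp measurable_snd))

theorem measurable_avg_snd {f : ℝ × (Fin m → ℝ) → ℝ} (hf : Measurable f) :
    Measurable fun ω : Fin n → Latent m => avg fun i => f (ω i).2 :=
  measurable_avg (f := fun ω : Latent m => f ω.2) (hf.comp measurable_snd)

theorem measurable_avg_sign : Measurable fun ω : Fin n → Latent m => avg fun i =>
    labelSign (ω i).1 :=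
  measurable_avg (f := fun ω : Latent m => labelSign ω.1) (measurable_labelSign.comp measurable_fst)

theorem measurable_sqrt_sum_sq {Ω : Type*} [MeasurableSpace Ω] {f : Fin m → Ω → ℝ}
    (hf : ∀ j, Measurable (f j)) : Measurable fun ω => Real.sqrt (∑ j, f j ω ^ 2) :=
  (Finset.measurable_sum _ fun j _ => (hf j).pow_const 2).sqrt

theorem measurable_lossStat : Measurable (lossStat : (Fin n → Latent m) → ℝ) := by
  unfold lossStat
  refine Measurable.add (Measurable.const_mul (measurable_sqrt_sum_sq fun j =>
    measurable_avg_sign_mul (f := fun z => z.2 j) (by fun_prop)) _) ?_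
  refine Measurable.add (Measurable.const_mul (measurable_sqrt_sum_sq fun j =>
    measurable_avg_snd (f := fun z => z.2 j) (by fun_prop)) _) ?_
  refine Measurable.add (Measurable.const_mul (measurable_sqrt_sum_sq fun j =>
    measurable_avg_snd (f := fun z => z.1 * z.2 j) (by fun_prop)) _) ?_
  refine Measurable.add (measurable_avg_sign.abs.const_mul _) ?_
  refine Measurable.add ((measurable_avg_snd (f := fun z => z.1) (by fun_prop)).abs.const_mul _) ?_
  exact ((measurable_avg_sign_mul (f := fun z => z.1) (by fun_prop)).abs.const_mul _).add
    ((measurable_avg_snd (f := fun z => z.1 ^ 2 - 1) (by fun_prop)).abs.const_mul _)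

/-- The constant is `16 + 33 + 16 + 6 + 6 + 32 + 16 * 8`; the last factor `8` is `√64`, from the
second-moment bound for `x² - 1`. -/
theorem lintegral_lossStat_le (hn : n ≠ 0) :
    ∫⁻ ω, ENNReal.ofReal (lossStat ω) ∂(latentSample m n) ≤
      ENNReal.ofReal (237 * Real.sqrt ((m + 1) / n)) := by
  have h1 : Real.sqrt (m / n) ≤ Real.sqrt ((m + 1) / n) :=
    Real.sqrt_le_sqrt (by gcongr; linarith)
  have h2 : Real.sqrt (1 / n) ≤ Real.sqrt ((m + 1) / n) :=
    Real.sqrt_le_sqrt (by gcongr; linarith [(Nat.cast_nonneg m : (0 : ℝ) ≤ m)])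
  have h3 : Real.sqrt (64 / n) = 8 * Real.sqrt (1 / n) := by
    rw [show (64 / n : ℝ) = 8 ^ 2 * (1 / n) by ring, Real.sqrt_mul (by norm_num),
      Real.sqrt_sq (by norm_num)]
  have key : ∫⁻ ω, ENNReal.ofReal (lossStat ω) ∂(latentSample m n) ≤ ENNReal.ofReal
      (16 * Real.sqrt (m / n) + (33 * Real.sqrt (m / n) + (16 * Real.sqrt (m / n) +
        (6 * Real.sqrt (1 / n) + (6 * Real.sqrt (1 / n) + (32 * Real.sqrt (1 / n) +
          16 * Real.sqrt (64 / n))))))) := by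
    unfold lossStat
    refine lintegral_ofReal_add_le (Measurable.const_mul (measurable_sqrt_sum_sq fun j =>
      measurable_avg_sign_mul (f := fun z => z.2 j) (by fun_prop)) _) (fun _ => by positivity)
      (fun _ => by positivity) (by positivity) (by positivity)
      (lintegral_ofReal_const_mul_le (by norm_num) (lintegral_avg_sign_mul_noise_le hn)) ?_
    refine lintegral_ofReal_add_le (Measurable.const_mul (measurable_sqrt_sum_sq fun j =>
      measurable_avg_snd (f := fun z => z.2 j) (by fun_prop)) _) (fun _ => by positivity)
      (fun _ => by positivity) (by positivity) (by positivity)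
      (lintegral_ofReal_const_mul_le (by norm_num) (lintegral_avg_noise_le hn)) ?_
    refine lintegral_ofReal_add_le (Measurable.const_mul (measurable_sqrt_sum_sq fun j =>
      measurable_avg_snd (f := fun z => z.1 * z.2 j) (by fun_prop)) _) (fun _ => by positivity)
      (fun _ => by positivity) (by positivity) (by positivity)
      (lintegral_ofReal_const_mul_le (by norm_num) (lintegral_avg_coord_mul_noise_le hn)) ?_
    refine lintegral_ofReal_add_le (measurable_avg_sign.abs.const_mul _) (fun _ => by positivity)
      (fun _ => by positivity) (by positivity) (by positivity)
      (lintegral_ofReal_const_mul_le (by norm_num) (lintegral_avg_sign_le hn)) ?_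
    refine lintegral_ofReal_add_le ((measurable_avg_snd (f := fun z => z.1)
      (by fun_prop)).abs.const_mul _) (fun _ => by positivity)
      (fun _ => by positivity) (by positivity) (by positivity)
      (lintegral_ofReal_const_mul_le (by norm_num) (lintegral_avg_coord_le hn)) ?_
    exact lintegral_ofReal_add_le ((measurable_avg_sign_mul (f := fun z => z.1)
      (by fun_prop)).abs.const_mul _) (fun _ => by positivity)
      (fun _ => by positivity) (by positivity) (by positivity)
      (lintegral_ofReal_const_mul_le (by norm_num) (lintegral_avg_sign_mul_coord_le hn))
      (lintegral_ofReal_const_mul_le (by norm_num) (lintegral_avg_coord_sq_le hn))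
  refine key.trans (ENNReal.ofReal_le_ofReal ?_)
  rw [h3]
  linarith

theorem four_le_log {x : ℝ} (hx : 68 ≤ x) : 4 ≤ Real.log x := by
  rw [Real.le_log_iff_exp_le (by linarith)]
  have h : Real.exp 4 = Real.exp 1 ^ 4 := by rw [← Real.exp_nat_mul]; norm_num
  have h1 := pow_le_pow_left₀ (Real.exp_nonneg 1) Real.exp_one_lt_d9.le 4
  rw [h]
  refine h1.trans (le_trans ?_ hx)
  norm_num

/-- With `ε = M⁻¹ / 64` the square costs at most `3ε` above `1`, and the rounding term, of order `M
/ n²`, at most another `ε`; together `M⁻¹ / 16`. -/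
theorem grid_constant_le {M ε r : ℝ} (hM : 1 ≤ M) (hε : ε = M⁻¹ / 64)
    (hn : 1440000 * M ^ 2 ≤ n) (hr0 : 0 ≤ r) (hr : r ≤ 2 / (n : ℝ) ^ 2) :
    (1 + ε) * (1 + ε) + (1 + 1 / ε) * r ≤ 1 + M⁻¹ / 16 := by
  have hM0 : 0 < M := by linarith
  have hn0 : (0 : ℝ) < n := by nlinarith
  have hη1 : M⁻¹ ≤ 1 := inv_le_one_of_one_le₀ hM
  have hη0 : 0 < M⁻¹ := inv_pos.mpr hM0
  have e1 : 1 / ε = 64 * M := by rw [hε]; field_simp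
  have hr2 : (1 + 64 * M) * r ≤ M⁻¹ / 64 := by
    have h1 : (1 + 64 * M) * r ≤ 65 * M * (2 / (n : ℝ) ^ 2) :=
      mul_le_mul (by linarith) hr hr0 (by positivity)
    refine h1.trans ?_
    rw [← mul_div_assoc, div_le_iff₀ (by positivity), inv_eq_one_div, div_div, div_mul_eq_mul_div,
      le_div_iff₀ (by positivity)]
    have h2 : 1440000 * M ^ 2 * 1 ≤ n * n := mul_le_mul hn (by nlinarith) zero_le_one hn0.le
    nlinarith
  rw [e1, hε]
  nlinarith

/-- With `L = log (nD)`, each coordinate of the grid has at most `(nD)² = exp (2L)` values, so the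
entropy is at most `2DL`. The sample size makes the Chernoff exponent at least `10DL`, since `360000
/ 32768 > 10`. -/
theorem largeNoise_exponent_le {M ε D : ℝ} (hM : 1 ≤ M) (hε : ε = M⁻¹ / 64) (hn : 1 ≤ n)
    (hD1 : (m : ℝ) + 1 = D) (hL : 4 ≤ Real.log (n * D))
    (hsmall : 360000 * (M ^ 2 * (D * Real.log (n * D))) ≤ n) :
    (2 * ((n * (m + 1) : ℕ) : ℝ) + 1) ^ m * Real.exp (-(n * ε ^ 2 / 8)) ≤ 1 / n := by
  have hn' : (1 : ℝ) ≤ n := by exact_mod_cast hn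
  have hM0 : 0 < M := by linarith
  have hD : 1 ≤ D := by rw [← hD1]; linarith [(Nat.cast_nonneg m : (0 : ℝ) ≤ m)]
  have hnD : 1 ≤ n * D := by nlinarith
  have hnD0 : 0 < n * D := by linarith
  set L := Real.log (n * D) with hLdef
  have hexpL : Real.exp L = n * D := Real.exp_log hnD0
  have h3 : 3 ≤ n * D := by
    have := Real.add_one_le_exp L
    rw [hexpL] at this
    linarith
  have h1 : (2 * ((n * (m + 1) : ℕ) : ℝ) + 1) ^ m ≤ Real.exp (2 * (D * L)) := by
    have e1 : 2 * ((n * (m + 1) : ℕ) : ℝ) + 1 ≤ Real.exp (2 * L) := by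
      have : Real.exp (2 * L) = (n * D) * (n * D) := by rw [two_mul, Real.exp_add, hexpL]
      rw [this]
      push_cast
      rw [hD1]
      nlinarith
    calc _ ≤ Real.exp (2 * L) ^ m := pow_le_pow_left₀ (by positivity) e1 m
      _ = Real.exp (m * (2 * L)) := by rw [← Real.exp_nat_mul]
      _ ≤ _ := Real.exp_le_exp.mpr (by nlinarith)
  have h2 : 10 * (D * L) ≤ n * ε ^ 2 / 8 := by
    have e2 : n * ε ^ 2 / 8 = n / (32768 * M ^ 2) := by rw [hε]; field_simp; norm_num
    rw [e2, le_div_iff₀ (by positivity)]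
    have : 0 ≤ M ^ 2 * (D * L) := by positivity
    linarith
  have h4 : L ≤ D * L := le_mul_of_one_le_left (by linarith) hD
  calc _ ≤ Real.exp (2 * (D * L)) * Real.exp (-(10 * (D * L))) := by
        refine mul_le_mul h1 (Real.exp_le_exp.mpr (by linarith)) (Real.exp_nonneg _)
          (Real.exp_nonneg _)
    _ = Real.exp (-(8 * (D * L))) := by rw [← Real.exp_add]; congr 1; ring
    _ ≤ Real.exp (-L) := Real.exp_le_exp.mpr (by linarith)
    _ ≤ 1 / n := by
        rw [Real.exp_neg, hexpL, ← one_div]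
        exact one_div_le_one_div_of_le (by linarith) (le_mul_of_one_le_right (by linarith) hD)

variable (b : OrthonormalBasis (Fin (m + 1)) ℝ (EuclideanSpace ℝ (Fin (m + 1))))

theorem expectedLoss_le_one (c : EuclideanSpace ℝ (Fin (m + 1))) {σ : ℝ} (hσ : 0 < σ) (γ : ℝ)
    (v : (Fin n → EuclideanSpace ℝ (Fin (m + 1))) → EuclideanSpace ℝ (Fin (m + 1))) :
    expectedLoss σ v (c + (σ * γ) • b 0, c - (σ * γ) • b 0) ≤ 1 := by
  refine (expectedLoss_le_lintegral b c hσ γ v rfl (g := fun _ => 1) measurable_const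
    fun ω => clusteringLoss_le_one b c hσ γ _).trans ?_
  simp

theorem expectedLoss_le_rate (hn : 68 ≤ n) (c : EuclideanSpace ℝ (Fin (m + 1))) {σ γ M : ℝ}
    (hσ : 0 < σ) (hγ : 0 < γ) (hM : M = max (1 / γ ^ 2) 1)
    (v : (Fin n → EuclideanSpace ℝ (Fin (m + 1))) → EuclideanSpace ℝ (Fin (m + 1)))
    (hv : ∀ X, IsTopEigenvector (sampleCovariance X) (v X)) :
    expectedLoss σ v (c + (σ * γ) • b 0, c - (σ * γ) • b 0) ≤
      ENNReal.ofReal (600 * M *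
        Real.sqrt ((m + 1 : ℝ) * Real.log (n * (m + 1 : ℝ)) / n)) := by
  have hn0 : n ≠ 0 := by omega
  have hnr : (68 : ℝ) ≤ n := by exact_mod_cast hn
  have hM1 : 1 ≤ M := hM ▸ le_max_right _ _
  have hM0 : 0 < M := by linarith
  set D : ℝ := (m : ℝ) + 1 with hD
  have hD1 : 1 ≤ D := by rw [hD]; linarith [(Nat.cast_nonneg m : (0 : ℝ) ≤ m)]
  set L := Real.log (n * D) with hLdef
  have hL : 4 ≤ L := four_le_log (by nlinarith)
  have hx : Real.sqrt (D * L / n) = Real.sqrt L * Real.sqrt (D / n) := by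
    rw [← Real.sqrt_mul (by linarith)]; congr 1; ring
  have hsL : 2 ≤ Real.sqrt L := Real.le_sqrt_of_sq_le (by linarith)
  set z := Real.sqrt (D / n) with hz
  have hz0 : 0 ≤ z := Real.sqrt_nonneg _
  -- Either the claim follows from the trivial bound, or its failure supplies the sample-size
  -- inequality `hsmall` that pays for the union bound.
  by_cases htriv : 1 ≤ 600 * M * Real.sqrt (D * L / n)
  · exact (expectedLoss_le_one b c hσ γ v).trans (by rwa [ENNReal.one_le_ofReal])
  rw [not_le] at htriv
  have hsmall : 360000 * (M ^ 2 * (D * L)) ≤ n := by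
    have h1 := mul_self_le_mul_self (by positivity) htriv.le
    have h2 := Real.sq_sqrt (by positivity : 0 ≤ D * L / n)
    have h3 : 360000 * M ^ 2 * (D * L / n) ≤ 1 := by nlinarith
    have h4 : 360000 * M ^ 2 * (D * L / n) = 360000 * (M ^ 2 * (D * L)) / n := by ring
    rw [h4, div_le_one (by linarith)] at h3
    exact h3
  have hDL : 4 ≤ D * L := by nlinarith
  have hnM : 1440000 * M ^ 2 ≤ n := by
    have := mul_le_mul_of_nonneg_left hDL (sq_nonneg M)
    linarith
  obtain ⟨ε, hε⟩ : ∃ ε : ℝ, ε = M⁻¹ / 64 := ⟨_, rfl⟩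
  have hε0 : 0 < ε := by rw [hε]; positivity
  have hη1 : M⁻¹ ≤ 1 := inv_le_one_of_one_le₀ hM1
  have hε1 : ε ≤ 1 := by rw [hε]; linarith
  -- The mesh `1 / (n d)` makes the rounding error at most `2 / n²`.
  have hK : 0 < n * (m + 1) := Nat.mul_pos (by omega) (by omega)
  have hgrid : (1 + ε) * (1 + ε) + (1 + 1 / ε) *
      (m / ((n * (m + 1) : ℕ) : ℝ) ^ 2 * (2 * (m + 1 : ℝ))) ≤ 1 + M⁻¹ / 16 := by
    refine grid_constant_le hM1 hε hnM (by positivity) ?_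
    push_cast
    rw [← hD, div_mul_eq_mul_div, div_le_div_iff₀ (by positivity) (by positivity)]
    have : (m : ℝ) * D ≤ D * D := by nlinarith
    have h5 := mul_le_mul_of_nonneg_right this (by positivity : (0 : ℝ) ≤ 2 * n ^ 2)
    nlinarith
  refine (expectedLoss_le_lintegral b c hσ γ v rfl (g := fun ω =>
    (largeNoise m n (n * (m + 1)) ε).indicator 1 ω + ENNReal.ofReal (M * lossStat ω))
    ((measurable_one.indicator (measurableSet_largeNoise _ _ _ _)).add
      (measurable_lossStat.const_mul M).ennreal_ofReal) fun ω => ?_).trans ?_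
  · by_cases hω : ω ∈ largeNoise m n (n * (m + 1)) ε
    · refine (clusteringLoss_le_one b c hσ γ _).trans ?_
      simp [hω]
    · rw [Set.indicator_of_notMem hω, zero_add]
      exact clusteringLoss_le_lossStat b hn0 c hσ hγ hM hK hε0 hgrid hv hω
  · change ∫⁻ ω, _ ∂(latentSample m n) ≤ _
    rw [lintegral_add_left (measurable_one.indicator (measurableSet_largeNoise _ _ _ _)),
      lintegral_indicator_one (measurableSet_largeNoise _ _ _ _)]
    refine (add_le_add (latentSample_largeNoise_le hn0 _ hε0 hε1)
      (lintegral_ofReal_const_mul_le hM0.le (lintegral_lossStat_le hn0))).trans ?_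
    rw [← hD, ← hz, ← ENNReal.ofReal_add (by positivity) (by positivity)]
    refine ENNReal.ofReal_le_ofReal ?_
    -- Altogether `32 / n + 1 / n + 237 M z ≤ 270 M z`. The condition `n ≥ 68` gives `log (nd) ≥ 4`,
    -- so `√L ≥ 2` and the constant `600` is ample.
    have h1 := largeNoise_exponent_le hM1 hε (by omega) hD.symm hL hsmall
    have h2 : Real.exp (-(n : ℝ) / 32) ≤ 32 / n := by
      have := Real.add_one_le_exp ((n : ℝ) / 32)
      rw [neg_div, Real.exp_neg, ← inv_div (n : ℝ) 32]
      exact inv_anti₀ (by positivity) (by linarith)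
    have h3 : 1 / (n : ℝ) ≤ z := by
      refine Real.le_sqrt_of_sq_le ?_
      rw [div_pow, div_le_div_iff₀ (by positivity) (by positivity)]
      nlinarith
    have h4 : z ≤ M * z := le_mul_of_one_le_left hz0 hM1
    have h5 : 2 * (M * z) ≤ Real.sqrt L * (M * z) :=
      mul_le_mul_of_nonneg_right hsL (by positivity)
    have h6 : (32 : ℝ) / n = 32 * (1 / n) := by ring
    rw [hx]
    nlinarith

end Rate

end GaussianMixtureClustering

end

/-! ### From the normalized separation back to the original parameters -/

theorem theorem1 (d n : ℕ) (hd : 1 ≤ d) (hn : max 68 (4 * d) ≤ n)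
    (σ lam : ℝ) (hσ : 0 < σ) (hlam : 0 < lam)
    (v : (Fin n → EuclideanSpace ℝ (Fin d)) → EuclideanSpace ℝ (Fin d))
    (hv : ∀ X, GaussianMixtureClustering.IsTopEigenvector
      (GaussianMixtureClustering.sampleCovariance X) (v X)) :
    (⨆ θ ∈ GaussianMixtureClustering.parameterClass d lam,
        GaussianMixtureClustering.expectedLoss σ v θ) ≤
      ENNReal.ofReal (600 * max (4 * σ ^ 2 / lam ^ 2) 1 *
        Real.sqrt ((d : ℝ) * Real.log ((n : ℝ) * (d : ℝ)) / (n : ℝ))) ∧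
    (2 * max 80 (14 * Real.sqrt (5 * (d : ℝ))) ≤ lam / σ →
      (⨆ θ ∈ GaussianMixtureClustering.parameterClass d lam,
        GaussianMixtureClustering.expectedLoss σ v θ) ≤
      ENNReal.ofReal (17 * Real.exp (-(n : ℝ) / 32) +
        9 * Real.exp (-lam ^ 2 / (80 * σ ^ 2)))) := by
  obtain ⟨m, rfl⟩ : ∃ m, d = m + 1 := ⟨d - 1, by omega⟩
  have hn68 : 68 ≤ n := (le_max_left _ _).trans hn
  have hframe : ∀ θ ∈ GaussianMixtureClustering.parameterClass (m + 1) lam,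
      ∃ (b : OrthonormalBasis (Fin (m + 1)) ℝ (EuclideanSpace ℝ (Fin (m + 1))))
        (c : EuclideanSpace ℝ (Fin (m + 1))) (γ : ℝ),
        lam / (2 * σ) ≤ γ ∧ θ = (c + (σ * γ) • b 0, c - (σ * γ) • b 0) := by
    intro θ hθ
    have hθ' : lam ≤ ‖θ.1 - θ.2‖ := hθ
    obtain ⟨b, c, h⟩ := GaussianMixtureClustering.exists_frame hσ θ (by
      intro h
      rw [h, sub_self, norm_zero] at hθ'
      linarith)
    exact ⟨b, c, _, by gcongr, h⟩
  have hγ0 : 0 < lam / (2 * σ) := by positivity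
  refine ⟨iSup₂_le fun θ hθ => ?_, fun hsep => iSup₂_le fun θ hθ => ?_⟩
  · obtain ⟨b, c, γ, hγ, rfl⟩ := hframe θ hθ
    refine (GaussianMixtureClustering.expectedLoss_le_rate b hn68 c hσ (hγ0.trans_le hγ) rfl v
      hv).trans (ENNReal.ofReal_le_ofReal ?_)
    push_cast
    have h1 : 1 / γ ^ 2 ≤ 4 * σ ^ 2 / lam ^ 2 := by
      have h2 : 4 * σ ^ 2 / lam ^ 2 = 1 / (lam / (2 * σ)) ^ 2 := by field_simp; norm_num
      rw [h2]
      gcongr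
    gcongr
  · obtain ⟨b, c, γ, hγ, rfl⟩ := hframe θ hθ
    have hγ' : 0 < γ := hγ0.trans_le hγ
    have h1 : 14 * Real.sqrt (5 * ((m + 1 : ℕ) : ℝ)) ≤ γ := by
      have h2 := (le_max_right 80 (14 * Real.sqrt (5 * ((m + 1 : ℕ) : ℝ))))
      have h3 : lam / σ = 2 * (lam / (2 * σ)) := by field_simp
      linarith
    -- `14² * 5 = 980 = 490 * 2`, where `2 (m + 1)` is the trace level.
    have h2 : 490 * (2 * (m + 1 : ℝ)) ≤ γ ^ 2 := by
      have h3 := pow_le_pow_left₀ (by positivity) h1 2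
      rw [mul_pow, Real.sq_sqrt (by positivity)] at h3
      push_cast at h3
      linarith
    refine (GaussianMixtureClustering.expectedLoss_le_exp b (by omega) c hσ hγ' h2 v hv).trans
      (ENNReal.ofReal_le_ofReal ?_)
    have h3 : Real.exp (-(γ ^ 2 / 20)) ≤ Real.exp (-lam ^ 2 / (80 * σ ^ 2)) := by
      refine Real.exp_le_exp.mpr ?_
      have h4 := pow_le_pow_left₀ hγ0.le hγ 2
      have h5 : -lam ^ 2 / (80 * σ ^ 2) = -((lam / (2 * σ)) ^ 2 / 20) := by field_simp; norm_num
      rw [h5]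
      linarith
    have h4 := Real.exp_nonneg (-(n : ℝ) / 32)
    have h5 := Real.exp_nonneg (-lam ^ 2 / (80 * σ ^ 2))
    linarith
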